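/- Let $1<t\le 9$ and $M>0$. For $r>0$ write $\mathbb D_r=\{z\in\mathbb C:|z|<r\}$, $\mathbb D=\mathbb D_1$, and for a function $f$ holomorphic on $\mathbb D_r$ put $M_f(r)=\sup_{\mathbb D_r}|f|$ and $v_f(r)=\sup_{a\in\mathbb C} n_{f+a}(r)$, where $n_g(r)$ denotes the number of zeros of $g$ in $\mathbb D_r$ counted with multiplicity ($n_g(r)=-\infty$ if $g\equiv 0$). Let $F$ be a nonconstant holomorphic function on $\mathbb D_t$ such that $$M_F(t)\le 1,\qquad M_F(1/t)\ge M,\qquad \frac{M_F(1/t)}{M_F(1/t^2)}\ge \sqrt t .$$ Set $N_F(t)=v_F(1/\sqrt t)$ and $$\lambda(t)=\frac{9(\sqrt t+1)^2}{(t-1)^2}\ln\!\left(\frac{2(\sqrt t+1)}{M(t-1)^2}\right),\qquad \gamma(t)=\frac{(\sqrt t+1)^4+18(\sqrt t+1)^2\ln\!\left(\frac{4e\,t^{3/2}}{\sqrt t-1}\right)}{2(t-1)^2},\qquad r_0(t)=\left(\frac{M(t-1)}{4(\sqrt t+1)}\right)^{\gamma(t)+1}.$$ Then there is a number $c\in\mathbb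 C$ with $|c|<1$ such that for every $y\in\mathbb C$ with $|y|\le r_0(t)$ and every $s\in(0,r_0(t)/3]$ there is $c_{y,s}\in\mathbb C$ with $|c_{y,s}|<s$ such that the set of zeros of the function $F-c-y-c_{y,s}$ in $\mathbb D$ contains at least $N_F(t)$ distinct points with pairwise distances greater than $\dfrac{s(t-1)}{\sqrt{\lambda(t)}}$. -/

import Mathlib

open Metric
open scoped ENNReal

/-- `M_f(r)`: the supremum of `|f|` over the open disk of radius `r` centred at `0`,
as an element of `[0, ∞]`. -/
noncomputable def supModulus (f : ℂ → ℂ) (r : ℝ) : ℝ≥0∞ :=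
  ⨆ z ∈ ball (0 : ℂ) r, ‖f z‖ₑ

open Classical in
/-- `n_f(r)`: the number of zeros, counted with multiplicity, of a function `f` holomorphic on the
open disk of radius `r` centred at `0`, as an element of `{0, 1, 2, …, ∞}`. A function that
vanishes identically on the disk gets the value `0`, the least element available (a common
convention is `-∞`; the supremum defining the valency below is the same for both). -/
noncomputable def zeroCount (f : ℂ → ℂ) (r : ℝ) : ℕ∞ :=
  if ∀ z ∈ ball (0 : ℂ) r, f z = 0 then 0
  else ⨆ (S : Finset ℂ) (_ : (S : Set ℂ) ⊆ ball (0 : ℂ) r), ∑ z ∈ S, analyticOrderAt f z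

/-- `v_f(r)`: the valency of `f` in the open disk of radius `r` centred at `0`. -/
noncomputable def valency (f : ℂ → ℂ) (r : ℝ) : ℕ∞ :=
  ⨆ c : ℂ, zeroCount (fun z => f z + c) r

/-- The constant `λ(t)`, which also depends on `M`. -/
noncomputable def lambdaConst (M t : ℝ) : ℝ :=
  9 * (√t + 1) ^ 2 / (t - 1) ^ 2 * Real.log (2 * (√t + 1) / (M * (t - 1) ^ 2))

/-- The constant `γ(t)`. -/
noncomputable def gammaConst (t : ℝ) : ℝ :=
  ((√t + 1) ^ 4 +
      18 * (√t + 1) ^ 2 * Real.log (4 * Real.exp 1 * t ^ (3 / 2 : ℝ) / (√t - 1))) /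
    (2 * (t - 1) ^ 2)

/-- The radius `r₀(t)`, which also depends on `M`. -/
noncomputable def rZero (M t : ℝ) : ℝ :=
  (M * (t - 1) / (4 * (√t + 1))) ^ (gammaConst t + 1)

/-!
Write `u = √t`. Two independent facts are combined.

*Many zeros.* Let `c` be a value for which `F - c` has the largest number `N` of zeros in the disk
of radius `1 / u`; it exists since a Jensen-type inequality bounds these numbers uniformly
(`exists_valency_eq`). The hypotheses say that `F` oscillates in the disk of radius `1 / t`, so
`F - c` is not small at some point there (`exists_le_norm_sub`). Splitting off a Blaschke product,
applying Harnack's inequality to the logarithm of the zero-free quotient, and choosing a radius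
which is far from the moduli of the zeros by the extremal property of the Chebyshev polynomials
yields a circle with radius in `[1 / u, 1]` on which `|F - c|` exceeds `4 r₀(t) / 3`
(`exists_circle_le_norm`, `rZero_add_lt`). By Rouché's theorem (`card_eq_card_of_norm_lt`) every
`F - c - v` with `|v| ≤ 4 r₀(t) / 3` has at least `N` zeros inside this circle, counted with
multiplicity.

*Separated zeros.* Let `ε = 2 δ / (t - 1)²`, where `δ` is the required separation. The set of points
of the unit disk where `|F'| ≤ ε` has an image of area at most `π ε²`. Since `ε < s`, this image
misses a value `w` in the disk of radius `s` about `c + y` (`exists_mem_ball_notMem_image`,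
`two_div_sq_mul_lt`). By the Cauchy estimate for `F''`, two distinct points at distance at most `δ`
with the same value satisfy `|F'| ≤ ε` (`norm_deriv_le_of_eq`). Hence the zeros of `F - w` in the
unit disk are simple and more than `δ` apart, and the first part provides `N` of them.

Both `ε < s` and the estimate of the exponent `γ(t)` use `M ≤ 1 / t`, which follows from Hadamard's
three circles theorem (`le_one_div_of_growth`).
-/

/-! ### Blaschke products -/

open Filter Topology ComplexConjugate in
/-- One Blaschke factor: dividing `f z = (z - ζ) * h z` by the Blaschke factor of the disk of
radius `R` with zero `ζ` does not increase the supremum of the modulus. -/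
lemma norm_blaschke_factor_mul_le {R B : ℝ} {h : ℂ → ℂ} {ζ z : ℂ} (hζ : ‖ζ‖ < R)
    (hh : DifferentiableOn ℂ h (ball 0 R))
    (hB : ∀ w ∈ ball (0 : ℂ) R, ‖(w - ζ) * h w‖ ≤ B) (hz : z ∈ ball (0 : ℂ) R) :
    ‖((R : ℂ) ^ 2 - conj ζ * z) / R * h z‖ ≤ B := by
  have hR : 0 < R := (norm_nonneg _).trans_lt hζ
  have hz' : ‖z‖ < R := by simpa using hz
  -- The maximum principle is applied on each slightly smaller disk.
  have key : ∀ r : ℝ, max ‖z‖ ‖ζ‖ < r → r < R →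
      ‖((r : ℂ) ^ 2 - conj ζ * z) / r * h z‖ ≤ B := by
    intro r hr hrR
    have hr0 : 0 < r := (norm_nonneg z).trans_lt ((le_max_left _ _).trans_lt hr)
    have hsub : closure (ball (0 : ℂ) r) ⊆ ball 0 R :=
      closure_ball_subset_closedBall.trans (closedBall_subset_ball hrR)
    refine Complex.norm_le_of_forall_mem_frontier_norm_le (U := ball (0 : ℂ) r)
      (f := fun z => ((r : ℂ) ^ 2 - conj ζ * z) / r * h z) isBounded_ball ?_ ?_ ?_
    · apply DifferentiableOn.diffContOnCl
      exact DifferentiableOn.mul (by fun_prop) (hh.mono hsub)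
    · intro w hw
      rw [frontier_ball _ hr0.ne'] at hw
      have hwr : ‖w‖ = r := by simpa using hw
      have e : ((r : ℂ) ^ 2 - conj ζ * w) = w * conj (w - ζ) := by
        rw [map_sub, mul_sub, Complex.mul_conj, Complex.normSq_eq_norm_sq, hwr]
        push_cast; ring
      have := hB w (by simpa [hwr] using hrR)
      refine le_trans (le_of_eq ?_) this
      simp only [e, norm_mul, norm_div, RCLike.norm_conj, hwr, Complex.norm_real,
        Real.norm_eq_abs, abs_of_pos hr0]
      field_simp
    · exact subset_closure (by simpa using (le_max_left _ _).trans_lt hr)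
  have hmax : max ‖z‖ ‖ζ‖ < R := max_lt hz' hζ
  have hc : ContinuousAt (fun r : ℝ => ‖((r : ℂ) ^ 2 - conj ζ * z) / r * h z‖) R := by
    have : (R : ℂ) ≠ 0 := by exact_mod_cast hR.ne'
    fun_prop (disch := assumption)
  refine le_of_tendsto (hc.tendsto.mono_left nhdsWithin_le_nhds : Tendsto _ (𝓝[<] R) _) ?_
  filter_upwards [Ioo_mem_nhdsLT hmax] with r hr using key r hr.1 hr.2

open ComplexConjugate in
/-- Dividing a bounded holomorphic function by the Blaschke product over some of its zeros keeps
the bound. -/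
lemma norm_blaschke_prod_mul_le {R B : ℝ} (s : Multiset ℂ) {h : ℂ → ℂ}
    (hs : ∀ ζ ∈ s, ‖ζ‖ < R) (hh : DifferentiableOn ℂ h (ball 0 R))
    (hB : ∀ w ∈ ball (0 : ℂ) R, ‖(s.map fun ζ => w - ζ).prod * h w‖ ≤ B)
    {z : ℂ} (hz : z ∈ ball (0 : ℂ) R) :
    ‖(s.map fun ζ => ((R : ℂ) ^ 2 - conj ζ * z) / R).prod * h z‖ ≤ B := by
  induction s using Multiset.induction_on generalizing h z with
  | empty => simpa using hB z hz
  | cons ζ s ih =>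
    have hd : DifferentiableOn ℂ
        (fun w => (s.map fun ζ => ((R : ℂ) ^ 2 - conj ζ * w) / R).prod) (ball 0 R) := by
      clear ih hB hs
      induction s using Multiset.induction_on with
      | empty => simp
      | cons a s ih => simp only [Multiset.map_cons, Multiset.prod_cons]; fun_prop
    have h1 : ∀ w ∈ ball (0 : ℂ) R,
        ‖(w - ζ) * ((s.map fun ζ => ((R : ℂ) ^ 2 - conj ζ * w) / R).prod * h w)‖ ≤ B := by
      intro w hw
      have := ih (h := fun w => (w - ζ) * h w)
        (fun a ha => hs a (Multiset.mem_cons_of_mem ha)) (by fun_prop) (fun x hx => by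
          have := hB x hx
          simp only [Multiset.map_cons, Multiset.prod_cons] at this
          convert this using 2; ring) hw
      convert this using 2; ring
    have := norm_blaschke_factor_mul_le (hs ζ (Multiset.mem_cons_self _ _)) (hd.mul hh) h1 hz
    simp only [Multiset.map_cons, Multiset.prod_cons]
    convert this using 2
    simp only [Pi.mul_apply]; ring

open ComplexConjugate in
/-- The pseudohyperbolic distance in the disk of radius `R` is largest for antipodal points. -/
lemma norm_sub_le_mul_norm_sq_sub {R a b : ℝ} {z ζ : ℂ} (hz : ‖z‖ ≤ a) (hζ : ‖ζ‖ ≤ b)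
    (ha : a < R) (hb : b < R) :
    ‖z - ζ‖ ≤ (R * (a + b) / (R ^ 2 + a * b)) * ‖((R : ℂ) ^ 2 - conj ζ * z) / R‖ := by
  have ha0 := (norm_nonneg z).trans hz
  have hb0 := (norm_nonneg ζ).trans hζ
  have hR : 0 < R := ha0.trans_lt ha
  set x := ‖z‖ with hx
  set y := ‖ζ‖ with hy
  have hx0 : 0 ≤ x := norm_nonneg _
  have hy0 : 0 ≤ y := norm_nonneg _
  have hmono : (x + y) / (R ^ 2 + x * y) ≤ (a + b) / (R ^ 2 + a * b) := by
    rw [div_le_div_iff₀ (by positivity) (by positivity)]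
    have h1 : 0 ≤ (a - x) * (R ^ 2 - y * b) :=
      mul_nonneg (by linarith) (by nlinarith)
    have h2 : 0 ≤ (b - y) * (R ^ 2 - x * a) :=
      mul_nonneg (by linarith) (by nlinarith)
    nlinarith
  have key : ‖z - ζ‖ * (R ^ 2 + x * y) ≤ (x + y) * ‖(R : ℂ) ^ 2 - conj ζ * z‖ := by
    set c := (conj ζ * z).re with hc
    have hcl : -(x * y) ≤ c := by
      have := Complex.abs_re_le_norm (conj ζ * z)
      rw [norm_mul, RCLike.norm_conj] at this
      have := (abs_le.1 this).1
      nlinarith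
    have e1 : ‖z - ζ‖ ^ 2 = x ^ 2 + y ^ 2 - 2 * c := by
      rw [hx, hy, hc, ← Complex.normSq_eq_norm_sq, ← Complex.normSq_eq_norm_sq,
        ← Complex.normSq_eq_norm_sq]
      simp [Complex.normSq_apply]; ring
    have e2 : ‖(R : ℂ) ^ 2 - conj ζ * z‖ ^ 2 = R ^ 4 + x ^ 2 * y ^ 2 - 2 * R ^ 2 * c := by
      have hx2 : x ^ 2 = z.re * z.re + z.im * z.im := by
        rw [hx, ← Complex.normSq_eq_norm_sq, Complex.normSq_apply]
      have hy2 : y ^ 2 = ζ.re * ζ.re + ζ.im * ζ.im := by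
        rw [hy, ← Complex.normSq_eq_norm_sq, Complex.normSq_apply]
      rw [hx2, hy2, hc, ← Complex.normSq_eq_norm_sq, Complex.normSq_apply]
      simp [pow_two]
      ring
    have h1 : 0 ≤ (R ^ 2 + x * y) ^ 2 - R ^ 2 * (x + y) ^ 2 := by
      have : (R ^ 2 + x * y) ^ 2 - R ^ 2 * (x + y) ^ 2 = (R ^ 2 - x ^ 2) * (R ^ 2 - y ^ 2) := by
        ring
      rw [this]
      exact mul_nonneg (by nlinarith) (by nlinarith)
    -- Both sides are affine in `c`; they agree at `c = -(x * y)`.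
    refine (sq_le_sq₀ (by positivity) (by positivity)).1 ?_
    rw [mul_pow, mul_pow, e1, e2]
    nlinarith [mul_nonneg (by linarith : 0 ≤ c + x * y) h1]
  calc ‖z - ζ‖ ≤ (x + y) / (R ^ 2 + x * y) * ‖(R : ℂ) ^ 2 - conj ζ * z‖ := by
        rw [div_mul_eq_mul_div, le_div_iff₀ (by positivity)]; exact key
    _ ≤ (a + b) / (R ^ 2 + a * b) * ‖(R : ℂ) ^ 2 - conj ζ * z‖ := by gcongr
    _ = _ := by
        rw [norm_div, Complex.norm_real, Real.norm_eq_abs, abs_of_pos hR]; field_simp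

/-! ### Harnack's inequality -/

/-- A zero-free holomorphic function on a disk is an exponential. -/
lemma exists_exp_eq_on_ball {R : ℝ} {g : ℂ → ℂ} (hg : DifferentiableOn ℂ g (ball 0 R))
    (h0 : ∀ z ∈ ball (0 : ℂ) R, g z ≠ 0) :
    ∃ k : ℂ → ℂ, DifferentiableOn ℂ k (ball 0 R) ∧
      ∀ z ∈ ball (0 : ℂ) R, g z = Complex.exp (k z) := by
  rcases le_or_gt R 0 with hR | hR
  · exact ⟨0, by simp [ball_eq_empty.2 hR], by simp [ball_eq_empty.2 hR]⟩
  have hd : DifferentiableOn ℂ (fun z => deriv g z / g z) (ball 0 R) :=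
    (hg.deriv isOpen_ball).div hg h0
  obtain ⟨k, hk⟩ := hd.isExactOn_ball
  have h00 : (0 : ℂ) ∈ ball (0 : ℂ) R := mem_ball_self hR
  have hconst : ∀ z ∈ ball (0 : ℂ) R, g z * Complex.exp (-k z) = g 0 * Complex.exp (-k 0) := by
    intro z hz
    refine isOpen_ball.is_const_of_deriv_eq_zero (convex_ball (0 : ℂ) R).isPreconnected
      (f := fun z => g z * Complex.exp (-k z)) ?_ ?_ hz h00
    · exact hg.mul (fun z hz => ((hk z hz).neg.cexp).differentiableAt.differentiableWithinAt)
    · intro w hw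
      have h1 := (hg.differentiableAt (isOpen_ball.mem_nhds hw)).hasDerivAt
      have := (h1.mul (hk w hw).neg.cexp).deriv
      refine Eq.trans this ?_
      have := h0 w hw
      simp only [Pi.zero_apply]
      field_simp
      ring
  have hne : g 0 * Complex.exp (-k 0) ≠ 0 := mul_ne_zero (h0 0 h00) (Complex.exp_ne_zero _)
  refine ⟨fun z => k z + Complex.log (g 0 * Complex.exp (-k 0)), fun z hz =>
    ((hk z hz).differentiableAt.add_const _).differentiableWithinAt, fun z hz => ?_⟩
  rw [Complex.exp_add, Complex.exp_log hne, ← hconst z hz, mul_left_comm, ← Complex.exp_add]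
  simp

open ComplexConjugate in
/-- **Harnack's inequality** for the positive harmonic function `re p`, obtained from the Schwarz
lemma for the Cayley transform `(p - p 0) / (p + conj (p 0))`. -/
lemma abs_re_sub_re_le {R : ℝ} {p : ℂ → ℂ} (hp : DifferentiableOn ℂ p (ball 0 R))
    (h0 : ∀ z ∈ ball (0 : ℂ) R, 0 < (p z).re) {z : ℂ} (hz : ‖z‖ < R) :
    |(p z).re - (p 0).re| ≤ ‖z‖ / R * ((p z).re + (p 0).re) := by
  have hR : 0 < R := (norm_nonneg _).trans_lt hz
  have h00 := h0 0 (mem_ball_self hR)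
  have hne : ∀ w ∈ ball (0 : ℂ) R, p w + conj (p 0) ≠ 0 := by
    intro w hw h
    have := congrArg Complex.re h
    simp at this
    linarith [h0 w hw]
  have hsq : ∀ w, ‖p w - p 0‖ ^ 2 = ((p w).re - (p 0).re) ^ 2 + ((p w).im - (p 0).im) ^ 2 := by
    intro w
    rw [← Complex.normSq_eq_norm_sq, Complex.normSq_apply]; simp; ring
  have hsq' : ∀ w, ‖p w + conj (p 0)‖ ^ 2 =
      ((p w).re + (p 0).re) ^ 2 + ((p w).im - (p 0).im) ^ 2 := by
    intro w
    rw [← Complex.normSq_eq_norm_sq, Complex.normSq_apply]; simp; ring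
  have hS := Complex.dist_le_div_mul_dist_of_mapsTo_ball (c := 0) (R₁ := R) (R₂ := 1) (z := z)
    (f := fun w => (p w - p 0) / (p w + conj (p 0)))
    ((hp.sub_const _).div (hp.add_const _) hne) (fun w hw => by
      have := h0 w hw
      simp only [sub_self, zero_div, mem_closedBall, dist_zero_right, norm_div]
      refine div_le_one_of_le₀ ?_ (norm_nonneg _)
      refine (sq_le_sq₀ (norm_nonneg _) (norm_nonneg _)).1 ?_
      rw [hsq, hsq']
      nlinarith) (by simpa using hz)
  simp only [sub_self, zero_div, dist_zero_right, norm_div] at hS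
  have hzb : z ∈ ball (0 : ℂ) R := by simpa using hz
  rw [div_le_iff₀ (norm_pos_iff.2 (hne z hzb))] at hS
  set q := ‖z‖ / R with hq
  have hq0 : 0 ≤ q := by positivity
  have hq1 : q ≤ 1 := div_le_one_of_le₀ hz.le hR.le
  have hS' : ‖p z - p 0‖ ^ 2 ≤ (q * ‖p z + conj (p 0)‖) ^ 2 := by
    refine pow_le_pow_left₀ (norm_nonneg _) (hS.trans_eq ?_) 2
    rw [hq]; ring
  rw [mul_pow, hsq, hsq'] at hS'
  have hz0 := h0 z hzb
  refine abs_le_of_sq_le_sq ?_ (by positivity)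
  nlinarith [mul_nonneg (sub_nonneg.2 (pow_le_one₀ hq0 hq1 : q ^ 2 ≤ 1))
    (sq_nonneg ((p z).im - (p 0).im))]

/-- Harnack's inequality for `-log ‖g‖`, where `g` is a zero-free holomorphic function with values
in the closed unit disk. -/
lemma harnack_neg_log_norm {R : ℝ} {g : ℂ → ℂ} (hg : DifferentiableOn ℂ g (ball 0 R))
    (h0 : ∀ z ∈ ball (0 : ℂ) R, g z ≠ 0) (h1 : ∀ z ∈ ball (0 : ℂ) R, ‖g z‖ ≤ 1)
    {z : ℂ} (hz : ‖z‖ < R) :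
    -Real.log ‖g z‖ ≤ (R + ‖z‖) / (R - ‖z‖) * -Real.log ‖g 0‖ ∧
      -Real.log ‖g 0‖ ≤ (R + ‖z‖) / (R - ‖z‖) * -Real.log ‖g z‖ := by
  have hR : 0 < R := (norm_nonneg _).trans_lt hz
  obtain ⟨k, hk, hgk⟩ := exists_exp_eq_on_ball hg h0
  have hlog : ∀ w ∈ ball (0 : ℂ) R, -Real.log ‖g w‖ = (-k w).re := by
    intro w hw
    rw [hgk w hw, Complex.norm_exp, Real.log_exp, Complex.neg_re]
  have hnn : ∀ w ∈ ball (0 : ℂ) R, 0 ≤ (-k w).re := by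
    intro w hw
    rw [← hlog w hw]
    exact neg_nonneg.2 (Real.log_nonpos (norm_nonneg _) (h1 w hw))
  have hzb : z ∈ ball (0 : ℂ) R := by simpa using hz
  rw [hlog z hzb, hlog 0 (mem_ball_self hR)]
  have hsub : 0 < R - ‖z‖ := by linarith
  -- `re (-k)` may vanish, so Harnack's inequality is applied to `ε - k` with `ε → 0`.
  have key : ∀ ε : ℝ, 0 < ε →
      |(-k z).re - (-k 0).re| * R ≤ ‖z‖ * ((-k z).re + (-k 0).re) + 2 * ‖z‖ * ε := by
    intro ε hε
    have := abs_re_sub_re_le (p := fun w => ε - k w) (hk.const_sub _) (fun w hw => by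
      have := hnn w hw
      simp at this ⊢; linarith) hz
    simp only [Complex.sub_re, Complex.ofReal_re] at this
    rw [div_mul_eq_mul_div, le_div_iff₀ hR] at this
    simp only [Complex.neg_re]
    rw [show ε - (k z).re - (ε - (k 0).re) = -(k z).re - -(k 0).re by ring] at this
    linarith
  have key' : |(-k z).re - (-k 0).re| * R ≤ ‖z‖ * ((-k z).re + (-k 0).re) := by
    refine le_of_forall_pos_le_add fun δ hδ => (key (δ / (2 * R)) (by positivity)).trans ?_
    have : 2 * ‖z‖ * (δ / (2 * R)) ≤ δ := by
      rw [mul_div_assoc', div_le_iff₀ (by positivity)]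
      nlinarith
    linarith
  have ha := mul_le_mul_of_nonneg_right (le_abs_self ((-k z).re - (-k 0).re)) hR.le
  have hb := mul_le_mul_of_nonneg_right (neg_abs_le ((-k z).re - (-k 0).re)) hR.le
  constructor <;> rw [div_mul_eq_mul_div, le_div_iff₀ hsub] <;> linarith

/-! ### Factorization and counting of zeros -/

@[fun_prop]
lemma differentiable_prod_sub (s : Multiset ℂ) :
    Differentiable ℂ fun w : ℂ => (s.map fun ζ => w - ζ).prod := by
  induction s using Multiset.induction_on with
  | empty => simp
  | cons a s ih => simp only [Multiset.map_cons, Multiset.prod_cons]; fun_prop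

lemma prod_sub_eq_zero_iff {s : Multiset ℂ} {w : ℂ} :
    (s.map fun ζ => w - ζ).prod = 0 ↔ w ∈ s := by
  simp [Multiset.prod_eq_zero_iff, sub_eq_zero]

open ComplexConjugate in
lemma norm_prod_sub_le {R ρ a : ℝ} (s : Multiset ℂ) (hs : ∀ ζ ∈ s, ‖ζ‖ ≤ ρ) (hρ0 : 0 ≤ ρ)
    (hρ : ρ < R) {z : ℂ} (hz : ‖z‖ ≤ a) (ha : a < R) :
    ‖(s.map fun ζ => z - ζ).prod‖ ≤ (R * (a + ρ) / (R ^ 2 + a * ρ)) ^ s.card *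
      ‖(s.map fun ζ => ((R : ℂ) ^ 2 - conj ζ * z) / R).prod‖ := by
  have ha0 := (norm_nonneg z).trans hz
  have hR : 0 < R := ha0.trans_lt ha
  set q := R * (a + ρ) / (R ^ 2 + a * ρ)
  have hq : 0 ≤ q := by positivity
  induction s using Multiset.induction_on with
  | empty => simp
  | cons ζ s ih =>
    simp only [Multiset.map_cons, Multiset.prod_cons, norm_mul, Multiset.card_cons]
    rw [pow_succ q]
    have e1 := norm_sub_le_mul_norm_sq_sub (R := R) hz (hs ζ (Multiset.mem_cons_self _ _)) ha hρ
    have e2 := ih fun x hx => hs x (Multiset.mem_cons_of_mem hx)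
    calc _ ≤ (q * ‖((R : ℂ) ^ 2 - conj ζ * z) / R‖) *
          (q ^ s.card * ‖(s.map fun ζ => ((R : ℂ) ^ 2 - conj ζ * z) / R).prod‖) := by gcongr
      _ = _ := by rw [mul_mul_mul_comm, mul_comm q]

open ComplexConjugate in
/-- A Jensen-type inequality: a holomorphic function bounded by `B` on the disk of radius `R`
which has the zeros `s` in the closed disk of radius `ρ` is small at every `z` with `‖z‖ ≤ a`. -/
lemma norm_prod_sub_mul_le {R ρ a B : ℝ} (s : Multiset ℂ) {h : ℂ → ℂ}
    (hs : ∀ ζ ∈ s, ‖ζ‖ ≤ ρ) (hρ0 : 0 ≤ ρ) (hρ : ρ < R) (hh : DifferentiableOn ℂ h (ball 0 R))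
    (hB : ∀ w ∈ ball (0 : ℂ) R, ‖(s.map fun ζ => w - ζ).prod * h w‖ ≤ B)
    {z : ℂ} (hz : ‖z‖ ≤ a) (ha : a < R) :
    ‖(s.map fun ζ => z - ζ).prod * h z‖ ≤ (R * (a + ρ) / (R ^ 2 + a * ρ)) ^ s.card * B := by
  have ha0 := (norm_nonneg z).trans hz
  have hR : 0 < R := ha0.trans_lt ha
  have h1 := norm_blaschke_prod_mul_le s (fun ζ hζ => (hs ζ hζ).trans_lt hρ) hh hB
    (z := z) (by simpa using hz.trans_lt ha)
  set q := R * (a + ρ) / (R ^ 2 + a * ρ)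
  have hq : 0 ≤ q := by positivity
  have h2 := norm_prod_sub_le s hs hρ0 hρ hz ha
  calc _ ≤ q ^ s.card * ‖(s.map fun ζ => ((R : ℂ) ^ 2 - conj ζ * z) / R).prod‖ * ‖h z‖ := by
        rw [norm_mul]; gcongr
    _ = q ^ s.card * ‖(s.map fun ζ => ((R : ℂ) ^ 2 - conj ζ * z) / R).prod * h z‖ := by
        rw [norm_mul, mul_assoc]
    _ ≤ _ := by gcongr

/-- A bounded holomorphic function on a disk, not identically zero, is a product of the linear
factors at its zeros in a smaller closed disk and a function without zeros there. -/
lemma exists_zero_factorization {R ρ B : ℝ} {f : ℂ → ℂ} (hρ0 : 0 ≤ ρ) (hρ : ρ < R)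
    (hf : DifferentiableOn ℂ f (ball 0 R)) (hB : ∀ w ∈ ball (0 : ℂ) R, ‖f w‖ ≤ B)
    {z₀ : ℂ} (hz₀ : ‖z₀‖ < R) (hfz : f z₀ ≠ 0) :
    ∃ (s : Multiset ℂ) (h : ℂ → ℂ), (∀ ζ ∈ s, ‖ζ‖ ≤ ρ) ∧ DifferentiableOn ℂ h (ball 0 R) ∧
      (∀ z, ‖z‖ ≤ ρ → h z ≠ 0) ∧
      ∀ z ∈ ball (0 : ℂ) R, f z = (s.map fun ζ => z - ζ).prod * h z := by
  classical
  -- Otherwise one could split off arbitrarily many linear factors.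
  by_contra hcon
  have step : ∀ n : ℕ, ∃ (s : Multiset ℂ) (h : ℂ → ℂ), s.card = n ∧ (∀ ζ ∈ s, ‖ζ‖ ≤ ρ) ∧
      DifferentiableOn ℂ h (ball 0 R) ∧
      ∀ z ∈ ball (0 : ℂ) R, f z = (s.map fun ζ => z - ζ).prod * h z := by
    intro n
    induction n with
    | zero => exact ⟨0, f, rfl, by simp, hf, by simp⟩
    | succ n ih =>
      obtain ⟨s, h, hn, hs, hh, he⟩ := ih
      have : ∃ z, ‖z‖ ≤ ρ ∧ h z = 0 := by
        by_contra hno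
        exact hcon ⟨s, h, hs, hh, fun z hz hz0 => hno ⟨z, hz, hz0⟩, he⟩
      obtain ⟨ζ, hζ, hζ0⟩ := this
      refine ⟨ζ ::ₘ s, dslope h ζ, by simp [hn], ?_, ?_, fun z hz => ?_⟩
      · intro a ha
        rcases Multiset.mem_cons.1 ha with rfl | ha
        exacts [hζ, hs a ha]
      · exact (Complex.differentiableOn_dslope
          (isOpen_ball.mem_nhds (by simpa using hζ.trans_lt hρ))).2 hh
      · have := sub_smul_dslope h ζ z
        rw [hζ0, sub_zero, smul_eq_mul] at this
        rw [he z hz, Multiset.map_cons, Multiset.prod_cons, ← this, mul_left_comm, mul_assoc]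
  have hR : 0 < R := hρ0.trans_lt hρ
  set q := R * (‖z₀‖ + ρ) / (R ^ 2 + ‖z₀‖ * ρ) with hq
  have hq0 : 0 ≤ q := by positivity
  have hq1 : q < 1 := by
    rw [hq, div_lt_one (by positivity)]
    nlinarith [mul_pos (sub_pos.2 hz₀) (sub_pos.2 hρ)]
  have hbound : ∀ n : ℕ, ‖f z₀‖ ≤ q ^ n * B := by
    intro n
    obtain ⟨s, h, hn, hs, hh, he⟩ := step n
    have := norm_prod_sub_mul_le s hs hρ0 hρ hh (fun w hw => by rw [← he w hw]; exact hB w hw)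
      le_rfl hz₀
    rwa [← he z₀ (by simpa using hz₀), hn] at this
  have hlim : Filter.Tendsto (fun n : ℕ => q ^ n * B) Filter.atTop (nhds (0 * B)) :=
    (tendsto_pow_atTop_nhds_zero_of_lt_one hq0 hq1).mul_const B
  have := ge_of_tendsto' hlim hbound
  rw [zero_mul] at this
  exact hfz (norm_le_zero_iff.1 this)

lemma analyticOrderAt_prod_sub_mul {s : Multiset ℂ} {h : ℂ → ℂ} {z : ℂ} (hh : AnalyticAt ℂ h z)
    (hz : h z ≠ 0) :
    analyticOrderAt (fun w => (s.map fun ζ => w - ζ).prod * h w) z = s.count z := by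
  induction s using Multiset.induction_on with
  | empty => simpa using hh.analyticOrderAt_eq_zero.2 hz
  | cons ζ s ih =>
    have e : (fun w => ((ζ ::ₘ s).map fun ζ => w - ζ).prod * h w) =
        (fun w => w - ζ) * fun w => (s.map fun ζ => w - ζ).prod * h w := by
      ext w; simp [mul_assoc]
    have ha : AnalyticAt ℂ (fun w => (s.map fun ζ => w - ζ).prod * h w) z :=
      ((differentiable_prod_sub s).analyticAt z).mul hh
    rw [e, analyticOrderAt_mul (by fun_prop) ha, ih]
    rcases eq_or_ne z ζ with rfl | hne
    · have : analyticOrderAt (fun w : ℂ => w - z) z = 1 := analyticOrderAt_id_sub_const_self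
      rw [this]; simp [add_comm]
    · have : analyticOrderAt (fun w : ℂ => w - ζ) z = 0 := analyticOrderAt_id_sub_const_of_ne hne
      rw [this, Multiset.count_cons_of_ne hne]; simp

/-- The zeros of `f` in a disk, counted with multiplicity, are at most the linear factors in a
factorization of `f`. -/
lemma zeroCount_le_card {R ρ r : ℝ} {f h : ℂ → ℂ} {s : Multiset ℂ} (hr : r ≤ ρ) (hρ : ρ < R)
    (hh : DifferentiableOn ℂ h (ball 0 R)) (h0 : ∀ z, ‖z‖ ≤ ρ → h z ≠ 0)
    (he : ∀ z ∈ ball (0 : ℂ) R, f z = (s.map fun ζ => z - ζ).prod * h z) :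
    zeroCount f r ≤ s.card := by
  classical
  rw [zeroCount]
  split_ifs with hz
  · exact zero_le
  refine iSup₂_le fun S hS => ?_
  have hord : ∀ z ∈ S, analyticOrderAt f z = s.count z := by
    intro z hzS
    have hzr : ‖z‖ < r := by simpa using hS hzS
    have hzR : ball (0 : ℂ) R ∈ nhds z :=
      isOpen_ball.mem_nhds (by simpa using hzr.trans_le (hr.trans hρ.le))
    rw [analyticOrderAt_congr (Filter.eventually_of_mem hzR he),
      analyticOrderAt_prod_sub_mul (hh.analyticAt hzR) (h0 z (hzr.le.trans hr))]
  rw [Finset.sum_congr rfl hord, ← Nat.cast_sum]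
  refine Nat.cast_le.2 ?_
  rw [← Multiset.sum_count_eq_card (s := S ∪ s.toFinset) (m := s) (by simp +contextual)]
  exact Finset.sum_le_sum_of_subset Finset.subset_union_left

lemma one_le_zeroCount {r : ℝ} {f : ℂ → ℂ} {z : ℂ} (hz : z ∈ ball (0 : ℂ) r)
    (hf : AnalyticAt ℂ f z) (hfz : f z = 0) (hne : ∃ w ∈ ball (0 : ℂ) r, f w ≠ 0) :
    1 ≤ zeroCount f r := by
  obtain ⟨w, hw, hfw⟩ := hne
  rw [zeroCount, if_neg fun h => hfw (h w hw)]
  refine le_iSup₂_of_le {z} (by simpa using hz) ?_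
  rw [Finset.sum_singleton, Order.one_le_iff_ne_zero]
  exact analyticOrderAt_ne_zero.2 ⟨hf, hfz⟩

lemma exists_eq_zero_of_one_le_zeroCount {r : ℝ} {f : ℂ → ℂ} (h : 1 ≤ zeroCount f r) :
    ∃ z ∈ ball (0 : ℂ) r, f z = 0 := by
  by_contra! hno
  have : zeroCount f r ≤ 0 := by
    rw [zeroCount]
    split_ifs
    · exact le_rfl
    refine iSup₂_le fun S hS => le_of_eq (Finset.sum_eq_zero fun z hz => ?_)
    exact analyticOrderAt_eq_zero.2 (Or.inr (hno z (hS hz)))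
  exact absurd (h.trans this) (by simp)

/-! ### Rouché's theorem -/

open Real Complex in
/-- The argument principle for a function given with its zeros: the contour integral of the
logarithmic derivative counts the linear factors. -/
lemma circleIntegral_logDeriv_prod_sub_mul {R r : ℝ} (hr : 0 < r) (hrR : r < R) (s : Multiset ℂ)
    {h : ℂ → ℂ} (hs : ∀ ζ ∈ s, ‖ζ‖ < r) (hh : DifferentiableOn ℂ h (ball 0 R))
    (h0 : ∀ z, ‖z‖ ≤ r → h z ≠ 0) :
    (∮ z in C(0, r), logDeriv (fun w => (s.map fun ζ => w - ζ).prod * h w) z) =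
      s.card * (2 * π * I) := by
  have hsub : closedBall (0 : ℂ) r ⊆ ball 0 R := closedBall_subset_ball hrR
  have hlog : ∀ g : ℂ → ℂ, DifferentiableOn ℂ g (ball 0 R) → ∀ A ⊆ closedBall (0 : ℂ) r,
      (∀ z ∈ A, g z ≠ 0) → DifferentiableOn ℂ (logDeriv g) A := fun g hg A hA hne =>
    ((hg.deriv isOpen_ball).mono (hA.trans hsub)).div (hg.mono (hA.trans hsub)) hne
  induction s using Multiset.induction_on with
  | empty =>
    simp only [Multiset.map_zero, Multiset.prod_zero, one_mul, Multiset.card_zero, Nat.cast_zero,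
      zero_mul]
    refine DiffContOnCl.circleIntegral_eq_zero hr.le (DifferentiableOn.diffContOnCl ?_)
    rw [closure_ball _ hr.ne']
    exact hlog h hh _ subset_rfl fun z hz => h0 z (by simpa using hz)
  | cons ζ s ih =>
    have hζ := hs ζ (Multiset.mem_cons_self _ _)
    have hs' : ∀ a ∈ s, ‖a‖ < r := fun a ha => hs a (Multiset.mem_cons_of_mem ha)
    set P : ℂ → ℂ := fun w => (s.map fun ζ => w - ζ).prod * h w with hP
    have hPd : DifferentiableOn ℂ P (ball 0 R) :=
      (differentiable_prod_sub s).differentiableOn.mul hh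
    have hP0 : ∀ z ∈ sphere (0 : ℂ) r, P z ≠ 0 := by
      intro z hz
      have hz' : ‖z‖ = r := by simpa using hz
      exact mul_ne_zero (fun h => (hs' z (prod_sub_eq_zero_iff.1 h)).ne hz') (h0 z hz'.le)
    have hsp : ∀ z ∈ sphere (0 : ℂ) r, z - ζ ≠ 0 := by
      intro z hz h
      rw [sub_eq_zero.1 h] at hz
      exact hζ.ne (by simpa using hz)
    have e : ∀ z ∈ sphere (0 : ℂ) r,
        logDeriv (fun w => ((ζ ::ₘ s).map fun ζ => w - ζ).prod * h w) z =
          (z - ζ)⁻¹ + logDeriv P z := by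
      intro z hz
      have e1 : (fun w => ((ζ ::ₘ s).map fun ζ => w - ζ).prod * h w) =
          fun w => (w - ζ) * P w := by
        ext w; simp [hP, mul_assoc]
      rw [e1, logDeriv_mul z (hsp z hz) (hP0 z hz) (by fun_prop)
        (hPd.differentiableAt (isOpen_ball.mem_nhds (hsub (sphere_subset_closedBall hz))))]
      simp [logDeriv_apply]
    rw [circleIntegral.integral_congr hr.le e, circleIntegral.integral_add, ih hs',
      circleIntegral.integral_sub_inv_of_mem_ball (by simpa using hζ)]
    · push_cast [Multiset.card_cons]; ring
    · refine ContinuousOn.circleIntegrable hr.le (ContinuousOn.inv₀ (by fun_prop) hsp)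
    · exact (hlog P hPd _ sphere_subset_closedBall hP0).continuousOn.circleIntegrable hr.le

/-- **Rouché's theorem** for a perturbation by a constant `w`. The difference of the logarithmic
derivatives of `f - w` and `f` has the primitive `log (1 - w / f)` near the circle. -/
lemma card_eq_card_of_norm_lt {R r : ℝ} (hr : 0 < r) (hrR : r < R) {f h₁ h₂ : ℂ → ℂ}
    {s₁ s₂ : Multiset ℂ} {w : ℂ} (hf : DifferentiableOn ℂ f (ball 0 R))
    (hw : ∀ z ∈ sphere (0 : ℂ) r, ‖w‖ < ‖f z‖)
    (hs₁ : ∀ ζ ∈ s₁, ‖ζ‖ ≤ r) (hs₂ : ∀ ζ ∈ s₂, ‖ζ‖ ≤ r)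
    (hh₁ : DifferentiableOn ℂ h₁ (ball 0 R)) (hh₂ : DifferentiableOn ℂ h₂ (ball 0 R))
    (h₁0 : ∀ z, ‖z‖ ≤ r → h₁ z ≠ 0) (h₂0 : ∀ z, ‖z‖ ≤ r → h₂ z ≠ 0)
    (he₁ : ∀ z ∈ ball (0 : ℂ) R, f z = (s₁.map fun ζ => z - ζ).prod * h₁ z)
    (he₂ : ∀ z ∈ ball (0 : ℂ) R, f z - w = (s₂.map fun ζ => z - ζ).prod * h₂ z) :
    s₁.card = s₂.card := by
  have hsub : sphere (0 : ℂ) r ⊆ ball 0 R :=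
    sphere_subset_closedBall.trans (closedBall_subset_ball hrR)
  have hf0 : ∀ z ∈ sphere (0 : ℂ) r, f z ≠ 0 := fun z hz h => by
    have := hw z hz
    rw [h, norm_zero] at this
    exact absurd this (norm_nonneg w).not_gt
  have hfw0 : ∀ z ∈ sphere (0 : ℂ) r, f z - w ≠ 0 := fun z hz h => by
    have := hw z hz
    rw [sub_eq_zero.1 h] at this
    exact this.false
  have hlt : ∀ (g h : ℂ → ℂ) (s : Multiset ℂ), (∀ z ∈ sphere (0 : ℂ) r, g z ≠ 0) →
      (∀ ζ ∈ s, ‖ζ‖ ≤ r) → (∀ z ∈ ball (0 : ℂ) R, g z = (s.map fun ζ => z - ζ).prod * h z) →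
      ∀ ζ ∈ s, ‖ζ‖ < r := by
    intro g h s hg hs he ζ hζ
    refine lt_of_le_of_ne (hs ζ hζ) fun hn => ?_
    have hζs : ζ ∈ sphere (0 : ℂ) r := by simpa using hn
    refine hg ζ hζs ?_
    rw [he ζ (hsub hζs), prod_sub_eq_zero_iff.2 hζ, zero_mul]
  have hint : ∀ (g h : ℂ → ℂ) (s : Multiset ℂ),
      (∀ z ∈ ball (0 : ℂ) R, g z = (s.map fun ζ => z - ζ).prod * h z) →
      (∮ z in C(0, r), logDeriv g z) =
        ∮ z in C(0, r), logDeriv (fun w => (s.map fun ζ => w - ζ).prod * h w) z := by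
    intro g h s he
    refine circleIntegral.integral_congr hr.le fun z hz => ?_
    have hev := Filter.eventually_of_mem (isOpen_ball.mem_nhds (hsub hz)) he
    simp only [logDeriv_apply]
    rw [Filter.EventuallyEq.deriv_eq hev, he z (hsub hz)]
  have i₁ := (hint f h₁ s₁ he₁).trans
    (circleIntegral_logDeriv_prod_sub_mul hr hrR s₁ (hlt f h₁ s₁ hf0 hs₁ he₁) hh₁ h₁0)
  have i₂ := (hint (fun z => f z - w) h₂ s₂ he₂).trans
    (circleIntegral_logDeriv_prod_sub_mul hr hrR s₂ (hlt _ h₂ s₂ hfw0 hs₂ he₂) hh₂ h₂0)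
  have hci : ∀ g : ℂ → ℂ, DifferentiableOn ℂ g (ball 0 R) → (∀ z ∈ sphere (0 : ℂ) r, g z ≠ 0) →
      CircleIntegrable (logDeriv g) 0 r := fun g hg hne =>
    (((hg.deriv isOpen_ball).mono hsub).div (hg.mono hsub) hne).continuousOn.circleIntegrable hr.le
  have hzero : (∮ z in C(0, r), (logDeriv (fun z => f z - w) z - logDeriv f z)) = 0 := by
    refine circleIntegral.integral_eq_zero_of_hasDerivWithinAt hr.le
      (f := fun z => Complex.log ((f z - w) / f z)) fun z hz => ?_
    have hd := (hf.differentiableAt (isOpen_ball.mem_nhds (hsub hz))).hasDerivAt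
    have hslit : (f z - w) / f z ∈ Complex.slitPlane := by
      have h := Complex.mem_slitPlane_of_norm_lt_one (z := -w / f z) (by
        rw [norm_div, norm_neg, div_lt_one (norm_pos_iff.2 (hf0 z hz))]
        exact hw z hz)
      convert h using 1
      have := hf0 z hz
      field_simp
      ring
    have := ((hd.sub_const w).div hd (hf0 z hz)).clog hslit
    refine (this.congr_deriv ?_).hasDerivWithinAt
    have h1 := hf0 z hz
    have h2 := hfw0 z hz
    simp only [logDeriv_apply, deriv_sub_const, Pi.div_apply]
    field_simp
  rw [circleIntegral.integral_sub (hci _ (hf.sub_const w) hfw0) (hci f hf hf0), i₁, i₂,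
    sub_eq_zero] at hzero
  exact_mod_cast (mul_right_cancel₀ Complex.two_pi_I_ne_zero hzero).symm

/-! ### Lower bounds on circles -/

lemma norm_multiset_prod_map {α 𝕜 : Type*} [NormedField 𝕜] (s : Multiset α) (f : α → 𝕜) :
    ‖(s.map f).prod‖ = (s.map fun x => ‖f x‖).prod := by
  induction s using Multiset.induction_on with
  | empty => simp
  | cons a s ih => simp [ih]

lemma prod_map_le_prod_map_of_nonneg {α : Type*} (s : Multiset α) {f g : α → ℝ}
    (h0 : ∀ x ∈ s, 0 ≤ f x) (h : ∀ x ∈ s, f x ≤ g x) : (s.map f).prod ≤ (s.map g).prod := by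
  induction s using Multiset.induction_on with
  | empty => simp
  | cons a s ih =>
    simp only [Multiset.map_cons, Multiset.prod_cons]
    have ha := Multiset.mem_cons_self a s
    refine mul_le_mul (h a ha) (ih (fun x hx => h0 x (Multiset.mem_cons_of_mem hx))
      fun x hx => h x (Multiset.mem_cons_of_mem hx)) (Multiset.prod_nonneg ?_)
      ((h0 a ha).trans (h a ha))
    intro y hy
    obtain ⟨x, hx, rfl⟩ := Multiset.mem_map.1 hy
    exact h0 x (Multiset.mem_cons_of_mem hx)

open Polynomial in
/-- A monic real polynomial of degree `n` with real roots is at least `(L / 4) ^ n` in modulus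
somewhere on an interval of length `L`: among all polynomials bounded by `1` on `[-1, 1]` the
Chebyshev polynomial has the largest leading coefficient. -/
lemma exists_pow_le_prod_abs_sub {a b : ℝ} (hab : a < b) (s : Multiset ℝ) :
    ∃ r ∈ Set.Icc a b, ((b - a) / 4) ^ s.card ≤ (s.map fun ρ => |r - ρ|).prod := by
  by_contra! hcon
  have hn : s.card ≠ 0 := by
    intro h0
    have := hcon a ⟨le_rfl, hab.le⟩
    rw [Multiset.card_eq_zero.1 h0] at this
    simp at this
  set n := s.card with hns
  set L := b - a with hL
  have hL0 : 0 < L := sub_pos.2 hab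
  set P : ℝ[X] := (s.map fun ρ => X - C ρ).prod with hP
  have hPm : P.Monic := monic_multisetProd_X_sub_C s
  have hPn : P.natDegree = n := natDegree_multiset_prod_X_sub_C_eq_card s
  set ℓ : ℝ[X] := C (L / 2) * X + C ((a + b) / 2) with hℓ
  have hℓn : ℓ.natDegree = 1 := natDegree_linear (by positivity)
  have hℓc : ℓ.leadingCoeff = L / 2 := leadingCoeff_linear (by positivity)
  set ε : ℝ := (L / 4) ^ n with hε
  have hε0 : 0 < ε := by positivity
  have habs : ∀ r, |P.eval r| = (s.map fun ρ => |r - ρ|).prod := by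
    intro r
    rw [hP, eval_multiset_prod, Multiset.map_map, ← Real.norm_eq_abs, norm_multiset_prod_map]
    simp
  have hlead : (C ε⁻¹ * P.comp ℓ).leadingCoeff = 2 ^ n := by
    rw [leadingCoeff_mul, leadingCoeff_C, leadingCoeff_comp (by rw [hℓn]; exact one_ne_zero),
      hPm.leadingCoeff, hℓc, hPn, hε, one_mul, ← inv_pow, ← mul_pow]
    congr 1
    field_simp
    norm_num
  have hdeg : (C ε⁻¹ * P.comp ℓ).degree ≤ n := by
    refine degree_le_of_natDegree_le ((natDegree_C_mul_le _ _).trans ?_)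
    rw [natDegree_comp, hℓn, hPn, mul_one]
  have := Chebyshev.leadingCoeff_le_of_forall_abs_le_one hdeg fun x hx => by
    have hmem : L / 2 * x + (a + b) / 2 ∈ Set.Icc a b := by
      constructor <;> nlinarith [hx.1, hx.2]
    rw [eval_mul, eval_C, eval_comp, abs_mul, abs_of_pos (inv_pos.2 hε0), habs,
      inv_mul_le_iff₀ hε0, mul_one]
    simpa [hℓ] using (hcon _ hmem).le
  rw [hlead] at this
  exact absurd this (not_le.2 (pow_lt_pow_right₀ one_lt_two (by omega)))

/-- A bound for the number of zeros in terms of the size of the function at one point. -/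
lemma card_le_log_div {R ρ a B m : ℝ} {f h : ℂ → ℂ} {s : Multiset ℂ}
    (hB : ∀ w ∈ ball (0 : ℂ) R, ‖f w‖ ≤ B) (hs : ∀ ζ ∈ s, ‖ζ‖ ≤ ρ) (hρ0 : 0 < ρ) (hρ : ρ < R)
    (hh : DifferentiableOn ℂ h (ball 0 R))
    (he : ∀ z ∈ ball (0 : ℂ) R, f z = (s.map fun ζ => z - ζ).prod * h z) (ha : a < R)
    (hm : 0 < m) {z₀ : ℂ} (hz₀ : ‖z₀‖ ≤ a) (hmz : m ≤ ‖f z₀‖) :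
    s.card ≤ Real.log (B / m) / (1 - R * (a + ρ) / (R ^ 2 + a * ρ)) := by
  have ha0 : 0 ≤ a := (norm_nonneg _).trans hz₀
  have hR : 0 < R := by linarith
  have hz₀R : z₀ ∈ ball (0 : ℂ) R := by simp; linarith
  have hB0 : 0 < B := hm.trans_le (hmz.trans (hB z₀ hz₀R))
  set q := R * (a + ρ) / (R ^ 2 + a * ρ) with hq
  have hq0 : 0 < q := by positivity
  have hq1 : q < 1 := by
    rw [hq, div_lt_one (by positivity)]
    nlinarith [mul_pos (sub_pos.2 ha) (sub_pos.2 hρ)]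
  rw [le_div_iff₀ (by linarith)]
  have h1 : m ≤ q ^ s.card * B := by
    have := norm_prod_sub_mul_le s hs hρ0.le hρ hh
      (fun w hw => by rw [← he w hw]; exact hB w hw) hz₀ ha
    rw [← he z₀ hz₀R] at this
    exact hmz.trans this
  have h2 := Real.log_le_log hm h1
  rw [Real.log_mul (by positivity) hB0.ne', Real.log_pow] at h2
  rw [Real.log_div hB0.ne' hm.ne']
  have h3 : 1 - q ≤ -Real.log q := by linarith [Real.log_le_sub_one_of_pos hq0]
  nlinarith [mul_le_mul_of_nonneg_left h3 (Nat.cast_nonneg (α := ℝ) s.card)]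

open ComplexConjugate in
/-- A quantitative minimum modulus theorem: a bounded holomorphic function on a disk which is not
too small at one point is bounded from below on some circle. The zeros are split off by a Blaschke
product, the quotient is controlled by Harnack's inequality, and the radius is chosen far from the
moduli of the zeros. -/
lemma exists_circle_le_norm {R ρ a r₁ r₂ B m : ℝ} {f : ℂ → ℂ}
    (hf : DifferentiableOn ℂ f (ball 0 R)) (hB : ∀ w ∈ ball (0 : ℂ) R, ‖f w‖ ≤ B)
    (hm : 0 < m) (hr₁ : 0 ≤ r₁) (hr : r₁ < r₂) (hr₂ : r₂ < ρ) (ha : a < ρ) (hρ : ρ < R)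
    {z₀ : ℂ} (hz₀ : ‖z₀‖ ≤ a) (hmz : m ≤ ‖f z₀‖) :
    ∃ r ∈ Set.Icc r₁ r₂, ∀ z, ‖z‖ = r →
      B * Real.exp (-(((ρ + r₂) / (ρ - r₂) * ((ρ + a) / (ρ - a)) +
        Real.log (8 * R / (r₂ - r₁)) / (1 - R * (a + ρ) / (R ^ 2 + a * ρ))) *
          Real.log (B / m))) ≤ ‖f z‖ := by
  have ha0 : 0 ≤ a := (norm_nonneg _).trans hz₀
  have hρ0 : 0 < ρ := by linarith
  have hR : 0 < R := by linarith
  have hz₀R : z₀ ∈ ball (0 : ℂ) R := by simp; linarith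
  have hmB : m ≤ B := hmz.trans (hB z₀ hz₀R)
  have hB0 : 0 < B := hm.trans_le hmB
  set T := Real.log (B / m) with hT
  obtain ⟨s, h, hs, hh, hh0, he⟩ := exists_zero_factorization hρ0.le hρ hf hB
    (z₀ := z₀) (by linarith) (norm_pos_iff.1 (hm.trans_le hmz))
  have hB' : ∀ w ∈ ball (0 : ℂ) R, ‖(s.map fun ζ => w - ζ).prod * h w‖ ≤ B :=
    fun w hw => by rw [← he w hw]; exact hB w hw
  have hsR : ∀ ζ ∈ s, ‖ζ‖ < R := fun ζ hζ => (hs ζ hζ).trans_lt hρ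
  set q := R * (a + ρ) / (R ^ 2 + a * ρ) with hq
  have hq0 : 0 < q := by positivity
  have hq1 : q < 1 := by
    rw [hq, div_lt_one (by positivity)]
    nlinarith [mul_pos (sub_pos.2 (ha.trans hρ)) (sub_pos.2 hρ)]
  set n := s.card with hn
  have hnT : n ≤ T / (1 - q) :=
    card_le_log_div hB hs hρ0 hρ hh he (ha.trans hρ) hm hz₀ hmz
  set bl : ℂ → ℂ := fun w => (s.map fun ζ => ((R : ℂ) ^ 2 - conj ζ * w) / R).prod with hbl
  have hbld : Differentiable ℂ bl := by
    rw [hbl]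
    clear hn hs hsR he hB' hnT n hbl bl
    induction s using Multiset.induction_on with
    | empty => simp
    | cons a s ih => simp only [Multiset.map_cons, Multiset.prod_cons]; fun_prop
  set g : ℂ → ℂ := fun w => bl w * h w / B with hg
  have hρR : ball (0 : ℂ) ρ ⊆ ball 0 R := ball_subset_ball hρ.le
  have hgd : DifferentiableOn ℂ g (ball 0 ρ) := by
    have := hh.mono hρR
    fun_prop
  have hnB : ‖(B : ℂ)‖ = B := by rw [Complex.norm_real, Real.norm_eq_abs, abs_of_pos hB0]
  have hg0 : ∀ w ∈ ball (0 : ℂ) ρ, g w ≠ 0 := by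
    intro w hw
    have hwρ : ‖w‖ < ρ := by simpa using hw
    refine div_ne_zero (mul_ne_zero ?_ (hh0 w hwρ.le)) (by exact_mod_cast hB0.ne')
    rw [hbl]
    simp only [ne_eq, Multiset.prod_eq_zero_iff, Multiset.mem_map, not_exists, not_and]
    intro ζ hζ
    refine div_ne_zero (fun h0 => ?_) (by exact_mod_cast hR.ne')
    have h1 := congrArg norm (sub_eq_zero.1 h0)
    rw [norm_mul, RCLike.norm_conj, norm_pow, Complex.norm_real, Real.norm_eq_abs,
      abs_of_pos hR] at h1
    have := mul_le_mul (hs ζ hζ) hwρ.le (norm_nonneg _) hρ0.le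
    nlinarith
  have hg1 : ∀ w ∈ ball (0 : ℂ) ρ, ‖g w‖ ≤ 1 := by
    intro w hw
    rw [hg, norm_div, hnB, div_le_one hB0]
    exact norm_blaschke_prod_mul_le s hsR hh hB' (hρR hw)
  have hgz₀ : -Real.log ‖g z₀‖ ≤ T := by
    have h1 : m / B ≤ ‖g z₀‖ := by
      rw [hg, norm_div, hnB]
      refine div_le_div_of_nonneg_right (hmz.trans ?_) hB0.le
      rw [he z₀ hz₀R, norm_mul, norm_mul]
      refine mul_le_mul_of_nonneg_right ?_ (norm_nonneg _)
      refine (norm_prod_sub_le s hs hρ0.le hρ hz₀ (by linarith)).trans ?_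
      exact mul_le_of_le_one_left (norm_nonneg _) (pow_le_one₀ hq0.le hq1.le)
    have := Real.log_le_log (by positivity) h1
    rw [Real.log_div hm.ne' hB0.ne'] at this
    rw [hT, Real.log_div hB0.ne' hm.ne']
    linarith
  have hfrac : ∀ x y : ℝ, 0 ≤ x → x ≤ y → y < ρ → (ρ + x) / (ρ - x) ≤ (ρ + y) / (ρ - y) := by
    intro x y hx hxy hy
    rw [div_le_div_iff₀ (by linarith) (by linarith)]
    nlinarith
  have hnl : ∀ w ∈ ball (0 : ℂ) ρ, 0 ≤ -Real.log ‖g w‖ := fun w hw =>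
    neg_nonneg.2 (Real.log_nonpos (norm_nonneg _) (hg1 w hw))
  have hg00 : -Real.log ‖g 0‖ ≤ (ρ + a) / (ρ - a) * T := by
    have hz₀ρ : ‖z₀‖ < ρ := by linarith
    refine (harnack_neg_log_norm hgd hg0 hg1 hz₀ρ).2.trans ?_
    exact mul_le_mul (hfrac _ _ (norm_nonneg _) hz₀ ha) hgz₀ (hnl z₀ (by simpa using hz₀ρ))
      (div_nonneg (by linarith) (by linarith))
  obtain ⟨r, hrI, hrP⟩ := exists_pow_le_prod_abs_sub hr (s.map fun ζ => ‖ζ‖)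
  rw [Multiset.card_map, Multiset.map_map] at hrP
  refine ⟨r, hrI, fun z hz => ?_⟩
  have hr0 : 0 ≤ r := hr₁.trans hrI.1
  have hzρ : ‖z‖ < ρ := by linarith [hrI.2]
  have hzρ' : z ∈ ball (0 : ℂ) ρ := by simpa using hzρ
  have hgz : -Real.log ‖g z‖ ≤ (ρ + r₂) / (ρ - r₂) * ((ρ + a) / (ρ - a) * T) := by
    refine (harnack_neg_log_norm hgd hg0 hg1 hzρ).1.trans ?_
    exact mul_le_mul (hfrac _ _ (norm_nonneg _) (hz.le.trans hrI.2) hr₂) hg00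
      (hnl 0 (by simpa using hρ0)) (div_nonneg (by linarith) (by linarith))
  have hgexp : Real.exp (-((ρ + r₂) / (ρ - r₂) * ((ρ + a) / (ρ - a) * T))) ≤ ‖g z‖ := by
    rw [← Real.le_log_iff_exp_le (norm_pos_iff.2 (hg0 z hzρ'))]
    linarith
  have hblz : ‖bl z‖ ≤ (2 * R) ^ n := by
    rw [hbl, hn, norm_multiset_prod_map, ← Multiset.prod_replicate s.card (2 * R),
      ← Multiset.map_const']
    refine prod_map_le_prod_map_of_nonneg s (fun _ _ => norm_nonneg _) fun ζ hζ => ?_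
    rw [norm_div, Complex.norm_real, Real.norm_eq_abs, abs_of_pos hR, div_le_iff₀ hR]
    refine (norm_sub_le _ _).trans ?_
    rw [norm_mul, RCLike.norm_conj, norm_pow, Complex.norm_real, Real.norm_eq_abs, abs_of_pos hR]
    have := mul_le_mul (hsR ζ hζ).le (hzρ.trans hρ).le (norm_nonneg _) hR.le
    nlinarith
  have hpr : ((r₂ - r₁) / 4) ^ n ≤ ‖(s.map fun ζ => z - ζ).prod‖ := by
    refine hrP.trans ?_
    rw [norm_multiset_prod_map]
    refine prod_map_le_prod_map_of_nonneg s (fun _ _ => abs_nonneg _) fun ζ _ => ?_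
    rw [Function.comp_apply, ← hz]
    exact abs_norm_sub_norm_le z ζ
  have hL : 0 < r₂ - r₁ := sub_pos.2 hr
  have hBg : B * ‖g z‖ ≤ (2 * R) ^ n * ‖h z‖ := by
    rw [hg, norm_div, hnB, mul_div_cancel₀ _ hB0.ne', norm_mul]
    gcongr
  have hfz : B * (((r₂ - r₁) / (8 * R)) ^ n * ‖g z‖) ≤ ‖f z‖ := by
    rw [he z (hρR hzρ'), norm_mul]
    calc B * (((r₂ - r₁) / (8 * R)) ^ n * ‖g z‖)
        = ((r₂ - r₁) / (8 * R)) ^ n * (B * ‖g z‖) := by ring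
      _ ≤ ((r₂ - r₁) / (8 * R)) ^ n * ((2 * R) ^ n * ‖h z‖) := by gcongr
      _ = ((r₂ - r₁) / 4) ^ n * ‖h z‖ := by
          rw [← mul_assoc, ← mul_pow]
          congr 2
          field_simp
          norm_num
      _ ≤ _ := by gcongr
  refine le_trans ?_ hfz
  gcongr
  set Λ := Real.log (8 * R / (r₂ - r₁)) with hΛ
  have hΛ0 : 0 ≤ Λ := Real.log_nonneg ((one_le_div hL).2 (by linarith))
  have hpow : ((r₂ - r₁) / (8 * R)) ^ n = Real.exp (-(n * Λ)) := by
    rw [hΛ, ← Real.log_pow, ← Real.log_inv, Real.exp_log (by positivity), ← inv_pow, inv_div]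
  calc _ ≤ Real.exp (-(n * Λ) + -((ρ + r₂) / (ρ - r₂) * ((ρ + a) / (ρ - a) * T))) := by
        refine Real.exp_le_exp.2 ?_
        have : n * Λ ≤ T / (1 - q) * Λ := mul_le_mul_of_nonneg_right hnT hΛ0
        have e : Λ / (1 - q) * T = T / (1 - q) * Λ := by ring
        linarith
    _ ≤ _ := by
        rw [Real.exp_add, ← hpow]
        gcongr

/-! ### Three circles, and values with separated preimages -/

open Complex.HadamardThreeLines in
/-- **Hadamard's three circles theorem**, as the three lines theorem for `f ∘ exp`. -/
lemma norm_le_rpow_mul_rpow_of_norm_le {R r₁ r₂ a b : ℝ} {f : ℂ → ℂ}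
    (hf : DifferentiableOn ℂ f (ball 0 R)) (h₁ : 0 < r₁) (h₁₂ : r₁ < r₂) (h₂ : r₂ < R)
    (ha : ∀ z, ‖z‖ = r₁ → ‖f z‖ ≤ a) (hb : ∀ z, ‖z‖ = r₂ → ‖f z‖ ≤ b)
    {z : ℂ} (hz₁ : r₁ ≤ ‖z‖) (hz₂ : ‖z‖ ≤ r₂) :
    ‖f z‖ ≤ a ^ (1 - (Real.log ‖z‖ - Real.log r₁) / (Real.log r₂ - Real.log r₁)) *
      b ^ ((Real.log ‖z‖ - Real.log r₁) / (Real.log r₂ - Real.log r₁)) := by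
  have hl : Real.log r₁ < Real.log r₂ := Real.log_lt_log h₁ h₁₂
  have hr₂ : 0 < r₂ := h₁.trans h₁₂
  have hz0 : z ≠ 0 := norm_pos_iff.1 (h₁.trans_le hz₁)
  have hnorm : ∀ w : ℂ, w.re ≤ Real.log r₂ → ‖Complex.exp w‖ ≤ r₂ := fun w hw => by
    rw [Complex.norm_exp]
    exact (Real.exp_le_exp.2 hw).trans (Real.exp_log hr₂).le
  have hcl : closure (verticalStrip (Real.log r₁) (Real.log r₂)) ⊆
      verticalClosedStrip (Real.log r₁) (Real.log r₂) :=
    closure_minimal (Set.preimage_mono Set.Ioo_subset_Icc_self)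
      (isClosed_Icc.preimage Complex.continuous_re)
  have key := norm_le_interp_of_mem_verticalClosedStrip' (f := fun w => f (Complex.exp w))
    (z := Complex.log z) (a := a) (b := b) hl
    (by
      simp only [verticalClosedStrip, Set.mem_preimage, Complex.log_re, Set.mem_Icc]
      exact ⟨Real.log_le_log h₁ hz₁, Real.log_le_log (h₁.trans_le hz₁) hz₂⟩)
    (by
      apply DifferentiableOn.diffContOnCl
      refine DifferentiableOn.comp hf Complex.differentiable_exp.differentiableOn fun w hw => ?_
      simpa using (hnorm w (hcl hw).2).trans_lt h₂)
    (by
      have hc : ContinuousOn (fun z => ‖f z‖) (closedBall 0 r₂) :=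
        (hf.continuousOn.mono (closedBall_subset_ball h₂)).norm
      obtain ⟨C, hC⟩ := (isCompact_closedBall (0 : ℂ) r₂).bddAbove_image hc
      refine ⟨C, ?_⟩
      rintro _ ⟨w, hw, rfl⟩
      exact hC ⟨Complex.exp w, by simpa using hnorm w hw.2, rfl⟩)
    (fun w hw => ha _ (by
      rw [Complex.norm_exp, show w.re = Real.log r₁ from hw, Real.exp_log h₁]))
    (fun w hw => hb _ (by
      rw [Complex.norm_exp, show w.re = Real.log r₂ from hw, Real.exp_log hr₂]))
  simpa [Complex.exp_log hz0, Complex.log_re] using key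

open MeasureTheory in
/-- The image under a holomorphic function of the set where `‖f'‖ ≤ ε` in the disk of radius `r`
has area at most `ε ^ 2` times the area of the disk, so it does not cover any disk of a larger
radius `s` than `ε * r`. -/
lemma exists_mem_ball_notMem_image {f : ℂ → ℂ} {r ε s : ℝ} (hr : 0 < r) (hε : 0 ≤ ε)
    (hs : ε * r < s) (hf : ∀ z ∈ ball (0 : ℂ) r, DifferentiableAt ℂ f z) (c : ℂ) :
    ∃ w ∈ ball c s, ∀ z ∈ ball (0 : ℂ) r, f z = w → ε < ‖deriv f z‖ := by
  set A : Set ℂ := {z ∈ ball (0 : ℂ) r | ‖deriv f z‖ ≤ ε} with hA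
  have hAm : MeasurableSet A := by
    refine measurableSet_ball.inter ?_
    exact measurableSet_le (measurable_deriv f).norm measurable_const
  have hder : ∀ z ∈ A, HasFDerivWithinAt f
      ((ContinuousLinearMap.toSpanSingleton ℂ (deriv f z)).restrictScalars ℝ) A z := fun z hz =>
    ((hf z hz.1).hasDerivAt.hasFDerivAt.restrictScalars ℝ).hasFDerivWithinAt
  have hdet : ∀ a : ℂ,
      ((ContinuousLinearMap.toSpanSingleton ℂ a).restrictScalars ℝ).det = ‖a‖ ^ 2 := by
    intro a
    have e : (((ContinuousLinearMap.toSpanSingleton ℂ a).restrictScalars ℝ : ℂ →L[ℝ] ℂ) :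
        ℂ →ₗ[ℝ] ℂ) = Algebra.lmul ℝ ℂ a := by
      ext
      simp [mul_comm]
    rw [ContinuousLinearMap.det, e, ← Algebra.norm_apply, Algebra.norm_complex_apply,
      Complex.normSq_eq_norm_sq]
  have harea : volume (f '' A) ≤ ENNReal.ofReal (ε ^ 2) * volume (ball (0 : ℂ) r) := by
    refine (addHaar_image_le_lintegral_abs_det_fderiv volume hAm hder).trans ?_
    calc _ ≤ ∫⁻ _ in A, ENNReal.ofReal (ε ^ 2) := by
          refine setLIntegral_mono measurable_const fun z hz => ?_
          rw [hdet, abs_of_nonneg (by positivity)]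
          exact ENNReal.ofReal_le_ofReal (pow_le_pow_left₀ (norm_nonneg _) hz.2 2)
      _ = ENNReal.ofReal (ε ^ 2) * volume A := setLIntegral_const _ _
      _ ≤ _ := by gcongr; exact fun z hz => hz.1
  have hlt : volume (f '' A) < volume (ball c s) := by
    refine harea.trans_lt ?_
    have hs0 : 0 ≤ s := by nlinarith
    rw [Complex.volume_ball, Complex.volume_ball, ← mul_assoc, ← ENNReal.ofReal_pow hr.le,
      ← ENNReal.ofReal_mul (by positivity), ← ENNReal.ofReal_pow hs0, ← mul_pow]
    refine ENNReal.mul_lt_mul_left (by simp [NNReal.pi_ne_zero]) ENNReal.coe_ne_top ?_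
    have : 0 ≤ ε * r := by positivity
    rw [ENNReal.ofReal_lt_ofReal_iff (by nlinarith)]
    nlinarith
  have hns : ¬ ball c s ⊆ f '' A := fun h => (measure_mono h).not_gt hlt
  obtain ⟨w, hw, hwA⟩ := Set.not_subset.1 hns
  exact ⟨w, hw, fun z hz hzw => not_le.1 fun hle => hwA ⟨z, ⟨hz, hle⟩, hzw⟩⟩

/-- Two points of the unit disk with the same value have to be far apart unless the derivative is
small at one of them. -/
lemma norm_deriv_le_of_eq {t : ℝ} (ht : 1 < t) {F : ℂ → ℂ} (hF : DifferentiableOn ℂ F (ball 0 t))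
    (hB : ∀ z ∈ ball (0 : ℂ) t, ‖F z‖ ≤ 1) {z w : ℂ} (hz : z ∈ ball (0 : ℂ) 1)
    (hw : w ∈ ball (0 : ℂ) 1) (hzw : z ≠ w) (h : F z = F w) :
    ‖deriv F z‖ ≤ 2 / (t - 1) ^ 2 * dist z w := by
  have ht0 : 0 < t - 1 := sub_pos.2 ht
  have hsub : ball (0 : ℂ) 1 ⊆ ball 0 t := ball_subset_ball ht.le
  have hF' : DifferentiableOn ℂ (deriv F) (ball 0 t) := hF.deriv isOpen_ball
  have hd2 : ∀ x ∈ ball (0 : ℂ) 1, ‖deriv (deriv F) x‖ ≤ 2 / (t - 1) ^ 2 := by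
    intro x hx
    have hx1 : ‖x‖ < 1 := by simpa using hx
    have hcb : closedBall x (t - 1) ⊆ ball 0 t := fun y hy => by
      have h1 : ‖y - x‖ ≤ t - 1 := by simpa [dist_eq_norm] using hy
      have := norm_add_le (y - x) x
      rw [sub_add_cancel] at this
      simp only [mem_ball, dist_zero_right]
      linarith
    have := Complex.norm_iteratedDeriv_le_of_forall_mem_sphere_norm_le (f := F) (c := x)
      (C := 1) 2 ht0 ((hF.mono (closure_ball_subset_closedBall.trans hcb)).diffContOnCl)
      fun y hy => hB y (hcb (sphere_subset_closedBall hy))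
    simpa [iteratedDeriv_succ] using this
  have hlip : ∀ x ∈ segment ℝ z w, ‖deriv F x - deriv F z‖ ≤ 2 / (t - 1) ^ 2 * dist z w := by
    intro x hx
    have hx1 : x ∈ ball (0 : ℂ) 1 := (convex_ball (0 : ℂ) 1).segment_subset hz hw hx
    have h1 := (convex_ball (0 : ℂ) 1).norm_image_sub_le_of_norm_deriv_le
      (fun y hy => hF'.differentiableAt (isOpen_ball.mem_nhds (hsub hy))) hd2 hz hx1
    refine h1.trans ?_
    gcongr
    rw [← dist_eq_norm, dist_comm]
    have := dist_add_dist_of_mem_segment hx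
    linarith [dist_nonneg (x := x) (y := w)]
  have hg : ∀ x ∈ segment ℝ z w, HasDerivWithinAt (fun y => F y - deriv F z * y)
      (deriv F x - deriv F z) (segment ℝ z w) x := by
    intro x hx
    have hx1 : x ∈ ball (0 : ℂ) 1 := (convex_ball (0 : ℂ) 1).segment_subset hz hw hx
    have h1 := (hF.differentiableAt (isOpen_ball.mem_nhds (hsub hx1))).hasDerivAt
    simpa using (h1.fun_sub ((hasDerivAt_id' x).const_mul (deriv F z))).hasDerivWithinAt
  have := (convex_segment z w).norm_image_sub_le_of_norm_hasDerivWithin_le hg hlip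
    (left_mem_segment ℝ z w) (right_mem_segment ℝ z w)
  rw [h, sub_sub_sub_cancel_left, ← mul_sub, norm_mul, ← dist_eq_norm, ← dist_eq_norm,
    dist_comm w z] at this
  exact le_of_mul_le_mul_right this (dist_pos.2 hzw)

/-! ### Consequences of the normalization and numerical estimates -/

/-- The normalization forces `m ≤ 1 / t`: by Hadamard's three circles theorem the growth by the
factor `√t` between the radii `1 / t²` and `1 / t` propagates up to the radius `t`. -/
lemma le_one_div_of_growth {t m : ℝ} (ht : 1 < t) (hm : 0 < m) {F : ℂ → ℂ}
    (hF : DifferentiableOn ℂ F (ball 0 t)) (hB : ∀ z ∈ ball (0 : ℂ) t, ‖F z‖ ≤ 1)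
    {z₁ : ℂ} (hz₁ : ‖z₁‖ ≤ 1 / t) (hmz : ‖F z₁‖ = m)
    (hsmall : ∀ z, ‖z‖ ≤ 1 / t ^ 2 → ‖F z‖ ≤ m / √t) : m ≤ 1 / t := by
  have ht0 : 0 < t := by linarith
  have hu1 : 1 < √t := Real.lt_sqrt_of_sq_lt (by simpa using ht)
  have hmu : m / √t < m := div_lt_self hm hu1
  have hz₁' : 1 / t ^ 2 < ‖z₁‖ := by
    by_contra! h
    linarith [hsmall z₁ h]
  have h1t : 1 / t < 1 := (div_lt_one ht0).2 ht
  have hm1 : m ≤ 1 := hmz ▸ hB z₁ (by simp only [mem_ball, dist_zero_right]; linarith)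
  have hz0 : 0 < ‖z₁‖ := lt_trans (by positivity) hz₁'
  set L := Real.log t with hL
  have hL0 : 0 < L := Real.log_pos ht
  have hlz : Real.log ‖z₁‖ ≤ -L := by
    have := Real.log_le_log hz0 hz₁
    rwa [one_div, Real.log_inv] at this
  have hlm : Real.log m ≤ 0 := Real.log_nonpos hm.le hm1
  have hlog2 : Real.log (1 / t ^ 2) = -(2 * L) := by
    rw [one_div, Real.log_inv, Real.log_pow]; push_cast; ring
  have key : ∀ T ∈ Set.Ioo 1 t, Real.log m ≤ -(Real.log T + L) / 2 := by
    intro T hT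
    have hT0 : 0 < T := by linarith [hT.1]
    have hlT : 0 < Real.log T := Real.log_pos hT.1
    have h3 := norm_le_rpow_mul_rpow_of_norm_le hF (r₁ := 1 / t ^ 2) (r₂ := T) (a := m / √t)
      (b := 1) (by positivity) (hz₁'.trans_le (by linarith [hT.1])) hT.2
      (fun z hz => hsmall z hz.le)
      (fun z hz => hB z (by simpa [hz] using hT.2)) hz₁'.le (by linarith [hT.1])
    rw [Real.one_rpow, mul_one, hmz, hlog2] at h3
    have h4 := Real.log_le_log hm h3
    rw [Real.log_rpow (by positivity), Real.log_div hm.ne' (by positivity),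
      Real.log_sqrt ht0.le, ← hL] at h4
    have hden : 0 < Real.log T - -(2 * L) := by linarith
    have e : 1 - (Real.log ‖z₁‖ - -(2 * L)) / (Real.log T - -(2 * L)) =
        (Real.log T - Real.log ‖z₁‖) / (Real.log T - -(2 * L)) := by
      field_simp; ring
    rw [e, div_mul_eq_mul_div, le_div_iff₀ hden] at h4
    have h5 : (Real.log T - Real.log ‖z₁‖) * (Real.log m - L / 2) ≤
        (Real.log T + L) * (Real.log m - L / 2) :=
      mul_le_mul_of_nonpos_right (by linarith) (by linarith)
    have h6 : L * Real.log m ≤ L * (-(Real.log T + L) / 2) := by linarith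
    exact le_of_mul_le_mul_left h6 hL0
  have hlim : Real.log m ≤ -(Real.log t + L) / 2 := by
    have hc : ContinuousAt (fun T => -(Real.log T + L) / 2) t := by
      have := Real.continuousAt_log ht0.ne'
      fun_prop
    refine ge_of_tendsto (hc.tendsto.mono_left nhdsWithin_le_nhds :
      Filter.Tendsto _ (nhdsWithin t (Set.Iio t)) _) ?_
    filter_upwards [Ioo_mem_nhdsLT ht] with T hT using key T hT
  rw [← Real.log_le_log_iff hm (by positivity), one_div, Real.log_inv]
  linarith

/-- The hypotheses on the suprema of `F`, in terms of the point where `‖F‖` is maximal on the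
closed disk of radius `1 / t`. -/
lemma exists_norm_eq_of_supModulus {t M : ℝ} (ht : 1 < t) {F : ℂ → ℂ}
    (hF : DifferentiableOn ℂ F (ball 0 t))
    (hFM : ENNReal.ofReal M ≤ supModulus F (1 / t))
    (hFratio : ENNReal.ofReal √t ≤ supModulus F (1 / t) / supModulus F (1 / t ^ 2)) :
    ∃ z₁ : ℂ, ‖z₁‖ ≤ 1 / t ∧ M ≤ ‖F z₁‖ ∧ ∀ z, ‖z‖ ≤ 1 / t ^ 2 → ‖F z‖ ≤ ‖F z₁‖ / √t := by
  have ht0 : 0 < t := by linarith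
  have h1t : 1 / t < t := ((div_lt_one ht0).2 ht).trans ht
  have hsub : closedBall (0 : ℂ) (1 / t) ⊆ ball 0 t := closedBall_subset_ball h1t
  obtain ⟨z₁, hz₁, hmax⟩ := (isCompact_closedBall (0 : ℂ) (1 / t)).exists_isMaxOn
    ⟨0, by simp; positivity⟩ ((hF.continuousOn.mono hsub).norm)
  have hsup : supModulus F (1 / t) ≤ ENNReal.ofReal ‖F z₁‖ := by
    refine iSup₂_le fun z hz => ?_
    rw [← ofReal_norm]
    exact ENNReal.ofReal_le_ofReal (hmax (ball_subset_closedBall hz))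
  refine ⟨z₁, by simpa using hz₁, ?_, fun z hz => ?_⟩
  · exact (ENNReal.ofReal_le_ofReal_iff (norm_nonneg _)).1 (hFM.trans hsup)
  have hu : 0 < √t := Real.sqrt_pos.2 ht0
  have hball : ∀ z ∈ ball (0 : ℂ) (1 / t ^ 2), ‖F z‖ ≤ ‖F z₁‖ / √t := by
    intro z hz
    have h1 : ‖F z‖ₑ ≤ supModulus F (1 / t ^ 2) := le_iSup₂_of_le z hz le_rfl
    have h2 := (mul_le_mul_right h1 (ENNReal.ofReal √t)).trans
      ((ENNReal.mul_le_of_le_div hFratio).trans hsup)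
    rw [← ofReal_norm, ← ENNReal.ofReal_mul hu.le,
      ENNReal.ofReal_le_ofReal_iff (norm_nonneg _)] at h2
    rw [le_div_iff₀ hu]
    linarith
  have hcl : closure (ball (0 : ℂ) (1 / t ^ 2)) = closedBall 0 (1 / t ^ 2) :=
    closure_ball _ (by positivity)
  refine le_on_closure hball ?_ continuousOn_const (hcl ▸ by simpa using hz)
  rw [hcl]
  refine ((hF.continuousOn.mono hsub).mono (closedBall_subset_closedBall ?_)).norm
  exact one_div_le_one_div_of_le ht0 (by nlinarith)

/-- A nonconstant holomorphic function bounded by `1` does not attain the modulus `1`. -/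
lemma norm_lt_one_of_nonconstant {t : ℝ} {F : ℂ → ℂ} (hF : DifferentiableOn ℂ F (ball 0 t))
    (hFnc : ¬ ∃ a : ℂ, ∀ z ∈ ball (0 : ℂ) t, F z = a) (hB : ∀ z ∈ ball (0 : ℂ) t, ‖F z‖ ≤ 1)
    {z : ℂ} (hz : z ∈ ball (0 : ℂ) t) : ‖F z‖ < 1 := by
  refine lt_of_le_of_ne (hB z hz) fun h => hFnc ⟨F z, fun w hw => ?_⟩
  exact Complex.eqOn_of_isPreconnected_of_isMaxOn_norm (convex_ball (0 : ℂ) t).isPreconnected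
    isOpen_ball hF hz (fun x hx => by simpa [h] using hB x hx) hw

/-- The separation required of the zeros is smaller than what the area estimate provides. -/
lemma two_div_sq_mul_lt {t M s : ℝ} (ht1 : 1 < t) (ht9 : t ≤ 9) (hM : 0 < M) (hMt : M ≤ 1 / t)
    (hs : 0 < s) : 2 / (t - 1) ^ 2 * (s * (t - 1) / √(lambdaConst M t)) < s := by
  have ht0 : 0 < t - 1 := by linarith
  set u := √t with hu
  have hut : u ^ 2 = t := Real.sq_sqrt (by linarith)
  have hu1 : 1 < u := Real.lt_sqrt_of_sq_lt (by simpa using ht1)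
  have hu3 : u ≤ 3 := by
    rw [hu]; exact Real.sqrt_le_iff.2 ⟨by norm_num, by linarith⟩
  set X := 2 * (u + 1) / (M * (t - 1) ^ 2) with hX
  -- Equality holds at `t = 9` and `M = 1 / t`, so `t ≤ 9` keeps the logarithm positive.
  have hX98 : 9 / 8 ≤ X := by
    rw [hX, div_le_div_iff₀ (by norm_num) (by positivity)]
    have h1 : 9 * M * (t - 1) ^ 2 * t ≤ 9 * (t - 1) ^ 2 := by
      have : M * t ≤ 1 := by
        rw [le_div_iff₀ (by linarith)] at hMt; exact hMt
      nlinarith [mul_le_mul_of_nonneg_right this (sq_nonneg (t - 1))]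
    have h2 : 9 * (t - 1) ^ 2 ≤ 16 * (u + 1) * t := by
      rw [← hut]
      have h3 : 3 * (u - 1) ≤ 2 * u := by linarith
      have h4 : 9 * (u - 1) ^ 2 ≤ 4 * u ^ 2 := by nlinarith
      have h5 : 9 * (u - 1) ^ 2 * (u + 1) ≤ 16 * u ^ 2 := by nlinarith
      nlinarith
    have : 9 * (M * (t - 1) ^ 2) * t ≤ 2 * (u + 1) * 8 * t := by linarith
    exact le_of_mul_le_mul_right this (by linarith)
  have hlogX : 1 / 9 ≤ Real.log X := by
    have h1 := Real.one_sub_inv_le_log_of_pos (by linarith : 0 < X)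
    have h2 : X⁻¹ ≤ (9 / 8)⁻¹ := inv_anti₀ (by norm_num) hX98
    norm_num at h2
    linarith
  have hlam : (2 / (t - 1)) ^ 2 < lambdaConst M t := by
    have e : lambdaConst M t = 9 * (u + 1) ^ 2 / (t - 1) ^ 2 * Real.log X := rfl
    rw [e, div_pow, div_mul_eq_mul_div, div_lt_div_iff_of_pos_right (by positivity)]
    nlinarith
  have hsq := Real.lt_sqrt_of_sq_lt hlam
  have hsq0 : 0 < √(lambdaConst M t) := lt_trans (by positivity) hsq
  rw [div_mul_div_comm, div_lt_iff₀ (by positivity)]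
  rw [div_lt_iff₀ ht0] at hsq
  have : 2 * (s * (t - 1)) < s * (t - 1) * (√(lambdaConst M t) * (t - 1)) := by
    nlinarith [mul_pos hs ht0]
  linarith

/-- The elementary inequality behind the exponent `γ(t)`: the left-hand side is the exponent
produced by the minimum modulus theorem for `R = t`, `ρ = √t`, `a = 1 / t`, up to a factor
`7 / 5`. -/
lemma exponent_le_gammaConst {t : ℝ} (ht1 : 1 < t) (ht9 : t ≤ 9) :
    7 / 5 * ((√t + 1) / (√t - 1) * ((√t + 1 / t) / (√t - 1 / t)) +
      Real.log (8 * t / (1 - 1 / √t)) /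
        (1 - t * (1 / t + √t) / (t ^ 2 + 1 / t * √t))) ≤ gammaConst t + 1 := by
  have hrp : t ^ (3 / 2 : ℝ) = √t ^ 3 := by
    rw [Real.sqrt_eq_rpow, ← Real.rpow_natCast, ← Real.rpow_mul (by linarith)]
    norm_num
  rw [gammaConst, hrp]
  set u := √t with hu
  have hut : t = u ^ 2 := (Real.sq_sqrt (by linarith)).symm
  have hu1 : 1 < u := Real.lt_sqrt_of_sq_lt (by simpa using ht1)
  have hu3 : u ≤ 3 := by
    rw [hu]; exact Real.sqrt_le_iff.2 ⟨by norm_num, by linarith⟩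
  clear_value u
  subst hut
  have hd : 0 < u - 1 := by linarith
  set ℓ := Real.log (4 * Real.exp 1 * u ^ 3 / (u - 1)) with hℓ
  -- Equality holds at `u = 3 / 2`, the minimum of `u ^ 3 / (u - 1)`.
  have hu27 : 27 * (u - 1) ≤ 4 * u ^ 3 := by
    nlinarith [mul_nonneg (by linarith : 0 ≤ u + 3) (sq_nonneg (2 * u - 3))]
  have he : (2.7 : ℝ) < Real.exp 1 := by linarith [Real.exp_one_gt_d9]
  have hℓ4 : 4 ≤ ℓ := by
    rw [hℓ, Real.le_log_iff_exp_le (by positivity), le_div_iff₀ hd]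
    have h3 : Real.exp 1 ^ 3 ≤ 27 := by
      have := pow_le_pow_left₀ (Real.exp_pos 1).le (Real.exp_one_lt_d9.le.trans
        (by norm_num : (2.7182818286 : ℝ) ≤ 3)) 3
      linarith
    have h4 : Real.exp 4 = Real.exp 1 ^ 3 * Real.exp 1 := by
      rw [← pow_succ, ← Real.exp_nat_mul]; norm_num
    rw [h4]
    nlinarith [Real.exp_pos 1, mul_le_mul_of_nonneg_right h3
      (mul_pos (Real.exp_pos 1) hd).le]
  have hΛ : Real.log (8 * u ^ 2 / (1 - 1 / u)) ≤ ℓ := by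
    have e : 8 * u ^ 2 / (1 - 1 / u) = 8 * u ^ 3 / (u - 1) := by
      field_simp
    rw [e, hℓ]
    refine Real.log_le_log (by positivity) ?_
    gcongr
    linarith
  have hq : 1 / (1 - u ^ 2 * (1 / u ^ 2 + u) / ((u ^ 2) ^ 2 + 1 / u ^ 2 * u)) =
      (u ^ 5 + 1) / ((u + 1) * (u ^ 2 + 1)) / (u - 1) ^ 2 := by
    have h0 : (u ^ 5 + 1) - (u ^ 4 + u) = (u - 1) ^ 2 * ((u + 1) * (u ^ 2 + 1)) := by ring
    have h1 : u ^ 2 * (1 / u ^ 2 + u) / ((u ^ 2) ^ 2 + 1 / u ^ 2 * u) =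
        (u ^ 4 + u) / (u ^ 5 + 1) := by
      field_simp
      ring
    rw [h1, one_sub_div (by positivity), h0]
    field_simp
  have hK : (u + 1) / (u - 1) * ((u + 1 / u ^ 2) / (u - 1 / u ^ 2)) =
      (u + 1) * (u ^ 3 + 1) / (u ^ 2 + u + 1) / (u - 1) ^ 2 := by
    have h0 : u ^ 3 - 1 = (u - 1) * (u ^ 2 + u + 1) := by ring
    have h1 : (u + 1 / u ^ 2) / (u - 1 / u ^ 2) = (u ^ 3 + 1) / (u ^ 3 - 1) := by
      have : u ^ 3 - 1 ≠ 0 := by rw [h0]; positivity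
      have h2 : u - 1 / u ^ 2 = (u ^ 3 - 1) / u ^ 2 := by field_simp
      rw [h2]
      field_simp
    rw [h1, h0]
    field_simp
  have hβ : (u ^ 5 + 1) / ((u + 1) * (u ^ 2 + 1)) ≤ 61 / 10 := by
    rw [div_le_div_iff₀ (by positivity) (by norm_num)]
    -- The factor `3 - u` vanishes at `t = 9`, where the bound `61 / 10` is attained.
    have : 0 ≤ (3 - u) * (u ^ 3 + 2 * u ^ 2 + 0.9 * u + 1.7) * (u + 1) :=
      mul_nonneg (mul_nonneg (by linarith) (by positivity)) (by positivity)
    nlinarith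
  have hK' : 7 / 5 * ((u + 1) * (u ^ 3 + 1) / (u ^ 2 + u + 1)) ≤
      (u - 1) ^ 2 + (u + 1) ^ 2 / 2 + 1.84 := by
    rw [mul_div_assoc', div_le_iff₀ (by positivity)]
    nlinarith [mul_nonneg (sq_nonneg u) (sq_nonneg (u - 4.5)), sq_nonneg u]
  have hrhs : ((u + 1) ^ 4 + 18 * (u + 1) ^ 2 * ℓ) / (2 * (u ^ 2 - 1) ^ 2) + 1 =
      ((u - 1) ^ 2 + (u + 1) ^ 2 / 2 + 9 * ℓ) / (u - 1) ^ 2 := by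
    have : u ^ 2 - 1 = (u - 1) * (u + 1) := by ring
    rw [this]
    field_simp
    ring
  rw [hrhs, hK, div_eq_mul_one_div (Real.log _), hq, mul_div_assoc', ← add_div, mul_div_assoc',
    div_le_div_iff_of_pos_right (by positivity), mul_add]
  have hβ0 : 0 ≤ (u ^ 5 + 1) / ((u + 1) * (u ^ 2 + 1)) := by positivity
  have h1 := mul_le_mul hΛ hβ hβ0 (by linarith : 0 ≤ ℓ)
  linarith

/-- The lower bound on the circle exceeds the size of all perturbations that have to be allowed.
The factor `7 / 5` absorbs the passage from `log (2 / m)` to `-log A`, where `A` is the base of the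
power `rZero` and `m = 2 * A / √t` is the lower bound for `‖F - c‖` at a point. -/
lemma rZero_add_lt {t M E : ℝ} (ht1 : 1 < t) (ht9 : t ≤ 9) (hM : 0 < M) (hMt : M ≤ 1 / t)
    (hE : 7 / 5 * E ≤ gammaConst t + 1) (hE0 : 0 ≤ E) :
    rZero M t + rZero M t / 3 <
      2 * Real.exp (-(E * Real.log (2 / (M * (√t - 1) / (2 * √t))))) := by
  rw [rZero]
  set γ := gammaConst t
  set u := √t with hu
  have hut : t = u ^ 2 := (Real.sq_sqrt (by linarith)).symm
  have hu1 : 1 < u := Real.lt_sqrt_of_sq_lt (by simpa using ht1)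
  have hu3 : u ≤ 3 := by
    rw [hu]; exact Real.sqrt_le_iff.2 ⟨by norm_num, by linarith⟩
  have hd : 0 < u - 1 := by linarith
  set A := M * (u - 1) / 4 with hA
  have hA0 : 0 < A := by positivity
  have e1 : M * (t - 1) / (4 * (u + 1)) = A := by
    rw [hA, hut]; field_simp; ring
  have e2 : 2 / (M * (u - 1) / (2 * u)) = u * A⁻¹ := by
    rw [hA]; field_simp; norm_num
  have hu0 : 0 < u := by linarith
  -- Equivalent to `log u - log A ≤ 7 / 5 * (-log A)`; it follows from `A ≤ (u - 1) / (4 * u ^ 2)`.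
  have hA2 : u ^ 5 * A ^ 2 ≤ 1 := by
    have h1 : A * u ^ 2 ≤ (u - 1) / 4 := by
      rw [hut, le_div_iff₀ (by positivity)] at hMt
      rw [hA]
      nlinarith [mul_le_mul_of_nonneg_right hMt hd.le]
    have h2 : (A * u ^ 2) ^ 2 ≤ ((u - 1) / 4) ^ 2 := pow_le_pow_left₀ (by positivity) h1 2
    have h3 : u * (u - 1) ^ 2 ≤ 3 * 2 ^ 2 :=
      mul_le_mul hu3 (pow_le_pow_left₀ hd.le (by linarith) 2) (by positivity) (by norm_num)
    calc u ^ 5 * A ^ 2 = u * (A * u ^ 2) ^ 2 := by ring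
      _ ≤ u * ((u - 1) / 4) ^ 2 := by gcongr
      _ ≤ 1 := by linarith
  have hlog : 5 * Real.log u + 2 * Real.log A ≤ 0 := by
    have := Real.log_nonpos (by positivity) hA2
    rw [Real.log_mul (by positivity) (by positivity), Real.log_pow, Real.log_pow] at this
    exact_mod_cast this
  have hlu : 0 ≤ Real.log u := Real.log_nonneg hu1.le
  rw [e1, e2, Real.log_mul (by positivity) (by positivity), Real.log_inv,
    Real.rpow_def_of_pos hA0]
  have hle : Real.exp (Real.log A * (γ + 1)) ≤ Real.exp (-(E * (Real.log u + -Real.log A))) := by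
    refine Real.exp_le_exp.2 ?_
    have h1 : E * (Real.log u - Real.log A) ≤ E * (7 / 5 * -Real.log A) :=
      mul_le_mul_of_nonneg_left (by linarith) hE0
    have h2 := mul_le_mul_of_nonneg_right hE (by linarith : 0 ≤ -Real.log A)
    linarith
  have := Real.exp_pos (-(E * (Real.log u + -Real.log A)))
  linarith

/-! ### Valency and the choice of the values -/

/-- `F` oscillates by at least `M * (1 - 1 / √t)` between `0` and the point `z₁`, hence it is far
from `c` at one of them. -/
lemma exists_le_norm_sub {t M : ℝ} (ht : 1 < t) (hM : 0 < M) {F : ℂ → ℂ} {z₁ : ℂ}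
    (hz₁ : ‖z₁‖ ≤ 1 / t) (hMz : M ≤ ‖F z₁‖)
    (hsmall : ∀ z, ‖z‖ ≤ 1 / t ^ 2 → ‖F z‖ ≤ ‖F z₁‖ / √t) (c : ℂ) :
    ∃ z₀ : ℂ, ‖z₀‖ ≤ 1 / t ∧ M * (√t - 1) / (2 * √t) ≤ ‖F z₀ - c‖ := by
  have hu1 : 1 < √t := Real.lt_sqrt_of_sq_lt (by simpa using ht)
  have hu0 : 0 < √t := by linarith
  have h0 := hsmall 0 (by simp; positivity)
  have h1 : M * (√t - 1) / √t ≤ ‖F z₁‖ - ‖F z₁‖ / √t := by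
    rw [div_le_iff₀ hu0, sub_mul, div_mul_cancel₀ _ hu0.ne']
    nlinarith
  have h2 : ‖F z₁‖ - ‖F 0‖ ≤ ‖F z₁ - c‖ + ‖F 0 - c‖ := by
    have h3 := norm_sub_le (F z₁ - c) (F 0 - c)
    rw [sub_sub_sub_cancel_right] at h3
    linarith [norm_sub_norm_le (F z₁) (F 0)]
  have e : M * (√t - 1) / √t = 2 * (M * (√t - 1) / (2 * √t)) := by field_simp
  rcases le_total (M * (√t - 1) / (2 * √t)) ‖F z₁ - c‖ with h | h
  · exact ⟨z₁, hz₁, h⟩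
  · exact ⟨0, by simp; linarith, by linarith⟩

/-- The valency in a smaller disk is finite and attained, by a value of the function. -/
lemma exists_valency_eq {t m a : ℝ} (ht : 1 < t) (ha : a < t) (hm : 0 < m) {F : ℂ → ℂ}
    (hF : DifferentiableOn ℂ F (ball 0 t)) (hB : ∀ z ∈ ball (0 : ℂ) t, ‖F z‖ < 1)
    (hlow : ∀ c, ∃ z₀ : ℂ, ‖z₀‖ ≤ a ∧ m ≤ ‖F z₀ - c‖) {r : ℝ} (hr0 : 0 < r) (hr : r ≤ 1) :
    ∃ c : ℂ, ‖c‖ < 1 ∧ valency F r = zeroCount (fun z => F z - c) r := by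
  have hrt : ball (0 : ℂ) r ⊆ ball 0 t := ball_subset_ball (hr.trans ht.le)
  have hzero : ∀ c, 1 ≤ zeroCount (fun z => F z + c) r → ‖c‖ < 1 := by
    intro c hc
    obtain ⟨z, hz, hz0⟩ := exists_eq_zero_of_one_le_zeroCount hc
    have := hB z (hrt hz)
    rwa [eq_neg_of_add_eq_zero_left hz0, norm_neg] at this
  set N : ℕ := ⌈Real.log (2 / m) / (1 - t * (a + 1) / (t ^ 2 + a * 1))⌉₊ with hN
  have hbound : ∀ c, zeroCount (fun z => F z + c) r ≤ N := by
    intro c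
    rcases lt_or_ge (zeroCount (fun z => F z + c) r) 1 with h | h
    · exact (Order.lt_one_iff.1 h).le.trans zero_le
    have hc := hzero c h
    obtain ⟨z₀, hz₀, hmz⟩ := hlow (-c)
    rw [sub_neg_eq_add] at hmz
    have hfB : ∀ w ∈ ball (0 : ℂ) t, ‖F w + c‖ ≤ 2 := fun w hw =>
      (norm_add_le _ _).trans (by linarith [hB w hw])
    obtain ⟨s, h, hs, hh, hh0, he⟩ := exists_zero_factorization zero_le_one ht
      (hF.add_const c) hfB (hz₀.trans_lt ha) (norm_pos_iff.1 (hm.trans_le hmz))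
    refine (zeroCount_le_card hr ht hh hh0 he).trans ?_
    have := card_le_log_div hfB hs one_pos ht hh he ha hm hz₀ hmz
    exact_mod_cast this.trans (Nat.le_ceil _)
  have hfin : valency F r < ⊤ := (iSup_le hbound).trans_lt (ENat.natCast_lt_top N)
  obtain ⟨c, hc⟩ := ENat.exists_eq_iSup_of_lt_top hfin
  refine ⟨-c, ?_, ?_⟩
  · rw [norm_neg]
    refine hzero c ?_
    rw [hc]
    refine le_trans ?_ (le_iSup (fun c => zeroCount (fun z => F z + c) r) (-F 0))
    have h0 : (0 : ℂ) ∈ ball (0 : ℂ) r := mem_ball_self hr0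
    refine one_le_zeroCount h0 ((hF.add_const _).analyticAt (isOpen_ball.mem_nhds (hrt h0)))
      (by simp) ?_
    by_contra! hcon
    obtain ⟨z₀, hz₀, hmz⟩ := hlow (F 0)
    have hz₀t : z₀ ∈ ball (0 : ℂ) t := by simpa using hz₀.trans_lt ha
    -- By the identity theorem `F` would be constant.
    have hev : (fun z => F z + -F 0) =ᶠ[nhds 0] 0 :=
      Filter.eventually_of_mem (isOpen_ball.mem_nhds h0) hcon
    have han := (hF.add_const (-F 0)).analyticOnNhd isOpen_ball
    have heq : F z₀ + -F 0 = 0 := han.eqOn_zero_of_preconnected_of_eventuallyEq_zero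
      (convex_ball (0 : ℂ) t).isPreconnected (hrt h0) hev hz₀t
    rw [sub_eq_add_neg, heq, norm_zero] at hmz
    linarith
  · simp only [sub_neg_eq_add]
    exact hc.symm

/-- If `f - w` has a nonzero derivative at each of its zeros in the closed disk, then the zeros
are simple, so that there are as many of them as linear factors. -/
lemma nodup_of_deriv_ne_zero {R ρ : ℝ} {f h : ℂ → ℂ} {s : Multiset ℂ} (hρ : ρ < R)
    (hs : ∀ ζ ∈ s, ‖ζ‖ ≤ ρ) (hh : DifferentiableOn ℂ h (ball 0 R))
    (he : ∀ z ∈ ball (0 : ℂ) R, f z = (s.map fun ζ => z - ζ).prod * h z)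
    (hd : ∀ ζ ∈ s, deriv f ζ ≠ 0) : s.Nodup := by
  rw [Multiset.nodup_iff_le]
  intro ζ hle
  obtain ⟨s', rfl⟩ := Multiset.le_iff_exists_add.1 hle
  have hζ : ζ ∈ ζ ::ₘ ζ ::ₘ 0 + s' := by simp
  refine hd ζ hζ ?_
  have hζR : ball (0 : ℂ) R ∈ nhds ζ :=
    isOpen_ball.mem_nhds (by simpa using (hs ζ hζ).trans_lt hρ)
  rw [Filter.EventuallyEq.deriv_eq (Filter.eventually_of_mem hζR he)]
  set g : ℂ → ℂ := fun z => (s'.map fun ζ => z - ζ).prod * h z with hg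
  have hgd : DifferentiableAt ℂ g ζ :=
    (differentiable_prod_sub s' ζ).mul (hh.differentiableAt hζR)
  have e : (fun z => ((ζ ::ₘ ζ ::ₘ 0 + s').map fun ζ => z - ζ).prod * h z) =
      fun z => (z - ζ) ^ 2 * g z := by
    ext z; simp [hg]; ring
  have h1 : HasDerivAt (fun z : ℂ => (z - ζ) ^ 2) 0 ζ := by
    simpa using ((hasDerivAt_id ζ).sub_const ζ).fun_pow 2
  rw [e, (h1.fun_mul hgd.hasDerivAt).deriv]
  simp

theorem mainTheorem6 (t M : ℝ) (ht1 : 1 < t) (ht9 : t ≤ 9) (hM : 0 < M) (F : ℂ → ℂ)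
    (hF : DifferentiableOn ℂ F (ball 0 t))
    (hFnc : ¬ ∃ a : ℂ, ∀ z ∈ ball (0 : ℂ) t, F z = a)
    (hFt : supModulus F t ≤ 1)
    (hFM : ENNReal.ofReal M ≤ supModulus F (1 / t))
    (hFratio : ENNReal.ofReal √t ≤ supModulus F (1 / t) / supModulus F (1 / t ^ 2)) :
    ∃ c : ℂ, ‖c‖ < 1 ∧
      ∀ y : ℂ, ‖y‖ ≤ rZero M t → ∀ s : ℝ, 0 < s → s ≤ rZero M t / 3 →
        ∃ cys : ℂ, ‖cys‖ < s ∧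
          ∃ Z : Finset ℂ,
            (∀ z ∈ Z, z ∈ ball (0 : ℂ) 1 ∧ F z - c - y - cys = 0) ∧
            valency F (1 / √t) ≤ (Z.card : ℕ∞) ∧
            ∀ z ∈ Z, ∀ w ∈ Z, z ≠ w → s * (t - 1) / √(lambdaConst M t) < dist z w := by
  have ht0 : 0 < t := by linarith
  have hu1 : 1 < √t := Real.lt_sqrt_of_sq_lt (by simpa using ht1)
  have hu0 : 0 < √t := by linarith
  have hut : √t < t := by nlinarith [Real.sq_sqrt ht0.le]
  have hiu : 1 / √t < 1 := (div_lt_one hu0).2 hu1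
  have hit : 1 / t < 1 := (div_lt_one ht0).2 ht1
  have hB : ∀ z ∈ ball (0 : ℂ) t, ‖F z‖ ≤ 1 := by
    intro z hz
    have : ‖F z‖ₑ ≤ 1 := (le_iSup₂_of_le z hz le_rfl).trans hFt
    rwa [← ofReal_norm, ENNReal.ofReal_le_one] at this
  have hB' : ∀ z ∈ ball (0 : ℂ) t, ‖F z‖ < 1 := fun z hz =>
    norm_lt_one_of_nonconstant hF hFnc hB hz
  obtain ⟨z₁, hz₁, hMz, hsmall⟩ := exists_norm_eq_of_supModulus ht1 hF hFM hFratio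
  have hMt : M ≤ 1 / t :=
    hMz.trans (le_one_div_of_growth ht1 (hM.trans_le hMz) hF hB hz₁ rfl hsmall)
  set m := M * (√t - 1) / (2 * √t) with hm
  have hm0 : 0 < m := div_pos (mul_pos hM (by linarith)) (by linarith)
  have hlow := exists_le_norm_sub ht1 hM hz₁ hMz hsmall
  obtain ⟨c, hc, hval⟩ := exists_valency_eq ht1 (hit.trans ht1) hm0 hF hB' hlow
    (r := 1 / √t) (by positivity) hiu.le
  refine ⟨c, hc, fun y hy s hs hsr => ?_⟩
  set f : ℂ → ℂ := fun z => F z - c with hf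
  have hfd : DifferentiableOn ℂ f (ball 0 t) := hF.sub_const c
  have hfB : ∀ w ∈ ball (0 : ℂ) t, ‖f w‖ ≤ 2 := fun w hw =>
    (norm_sub_le _ _).trans (by linarith [hB w hw])
  obtain ⟨z₀, hz₀, hmz⟩ := hlow c
  obtain ⟨r, hr, hcirc⟩ := exists_circle_le_norm hfd hfB hm0 (r₁ := 1 / √t) (r₂ := 1)
    (by positivity) hiu hu1 (hit.trans hu1) hut hz₀ hmz
  have hr0 : 0 < r := lt_of_lt_of_le (by positivity) hr.1
  have hrt : r < t := hr.2.trans_lt ht1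
  set E := (√t + 1) / (√t - 1) * ((√t + 1 / t) / (√t - 1 / t)) +
    Real.log (8 * t / (1 - 1 / √t)) / (1 - t * (1 / t + √t) / (t ^ 2 + 1 / t * √t)) with hE
  have hE0 : 0 ≤ E := by
    have h1 : 0 ≤ Real.log (8 * t / (1 - 1 / √t)) := by
      refine Real.log_nonneg ((one_le_div (by linarith)).2 ?_)
      have : 0 < 1 / √t := by positivity
      linarith
    have h2 : t * (1 / t + √t) / (t ^ 2 + 1 / t * √t) ≤ 1 := by
      refine div_le_one_of_le₀ ?_ (by positivity)
      nlinarith [mul_pos (sub_pos.2 (hit.trans ht1)) (sub_pos.2 hut)]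
    have h3 : 0 < √t - 1 / t := by linarith
    have h4 : 0 < √t - 1 := by linarith
    have h5 := div_nonneg h1 (sub_nonneg.2 h2)
    positivity
  have hr₀ := rZero_add_lt ht1 ht9 hM hMt (exponent_le_gammaConst ht1 ht9) hE0
  rw [← hE, ← hm] at hr₀
  -- The value `c + y + cys` is chosen away from the image of the set where `F'` is small.
  set δ := s * (t - 1) / √(lambdaConst M t) with hδ
  have hδ0 : 0 ≤ δ := div_nonneg (mul_nonneg hs.le (by linarith)) (Real.sqrt_nonneg _)
  have hsub1 : ball (0 : ℂ) 1 ⊆ ball 0 t := ball_subset_ball ht1.le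
  obtain ⟨w, hw, hwd⟩ := exists_mem_ball_notMem_image (f := F) (r := 1) (s := s)
    (ε := 2 / (t - 1) ^ 2 * δ) one_pos (by positivity)
    (by rw [mul_one]; exact two_div_sq_mul_lt ht1 ht9 hM hMt hs)
    (fun z hz => hF.differentiableAt (isOpen_ball.mem_nhds (hsub1 hz))) (c + y)
  rw [mem_ball, dist_eq_norm] at hw
  refine ⟨w - (c + y), hw, ?_⟩
  set v := w - c with hv
  have hvn : ∀ z ∈ sphere (0 : ℂ) r, ‖v‖ < ‖f z‖ := by
    intro z hz
    have h1 : ‖v‖ ≤ ‖w - (c + y)‖ + ‖y‖ := by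
      have := norm_add_le (w - (c + y)) y
      rwa [show w - (c + y) + y = v by rw [hv]; ring] at this
    have h2 := hcirc z (by simpa using hz)
    linarith
  have hsph : (r : ℂ) ∈ sphere (0 : ℂ) r := by simp [abs_of_pos hr0]
  have hfr : f r ≠ 0 := norm_pos_iff.1 ((norm_nonneg v).trans_lt (hvn r hsph))
  have hfvr : f r - v ≠ 0 := fun h => (hvn r hsph).ne (by rw [sub_eq_zero.1 h])
  have hrn : ‖(r : ℂ)‖ < t := by simpa [abs_of_pos hr0] using hrt
  obtain ⟨s₁, h₁, hs₁, hh₁, hh₁0, he₁⟩ := exists_zero_factorization hr0.le hrt hfd hfB hrn hfr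
  obtain ⟨s₂, h₂, hs₂, hh₂, hh₂0, he₂⟩ := exists_zero_factorization (f := fun z => f z - v)
    (B := 2 + ‖v‖) hr0.le hrt (hfd.sub_const v)
    (fun z hz => (norm_sub_le _ _).trans (by linarith [hfB z hz])) hrn hfvr
  have hcard : s₁.card = s₂.card :=
    card_eq_card_of_norm_lt hr0 hrt hfd hvn hs₁ hs₂ hh₁ hh₂ hh₁0 hh₂0 he₁ he₂
  have hzero : ∀ z ∈ s₂, z ∈ ball (0 : ℂ) 1 ∧ F z = w := by
    intro z hz
    have hzt : z ∈ ball (0 : ℂ) t := by simpa using (hs₂ z hz).trans_lt hrt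
    have h0 : f z - v = 0 := by rw [he₂ z hzt, prod_sub_eq_zero_iff.2 hz, zero_mul]
    refine ⟨?_, ?_⟩
    · have hne : ‖z‖ ≠ r := fun h =>
        (hvn z (by simpa using h)).ne (by rw [sub_eq_zero.1 h0])
      simpa using (lt_of_le_of_ne (hs₂ z hz) hne).trans_le hr.2
    · rw [hf, hv] at h0
      simpa [sub_eq_zero] using h0
  have hnodup : s₂.Nodup := by
    refine nodup_of_deriv_ne_zero hrt hs₂ hh₂ he₂ fun z hz => ?_
    have h1 := hwd z (hzero z hz).1 (hzero z hz).2
    have h2 : deriv (fun z => f z - v) z = deriv F z := by simp [hf]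
    rw [h2]
    exact norm_pos_iff.1 (lt_of_le_of_lt (by positivity) h1)
  refine ⟨⟨s₂, hnodup⟩, fun z hz => ⟨(hzero z hz).1, ?_⟩, ?_, fun z hz z' hz' hne => ?_⟩
  · rw [(hzero z hz).2]; ring
  · rw [hval, Finset.card_mk, ← hcard]
    exact zeroCount_le_card hr.1 hrt hh₁ hh₁0 he₁
  · have h1 := hwd z (hzero z hz).1 (hzero z hz).2
    have h2 := norm_deriv_le_of_eq ht1 hF hB (hzero z hz).1 (hzero z' hz').1 hne
      ((hzero z hz).2.trans (hzero z' hz').2.symm)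
    exact lt_of_mul_lt_mul_left (h1.trans_le h2) (by positivity)
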